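/- Let $k\ge 1$ and $N$ be integers with $N>2k$. Let $\mathbb{H}^N$ be the $N$-dimensional hyperbolic space (curvature $-1$), $o\in\mathbb{H}^N$ a fixed pole, $r$ the geodesic distance from $o$, $dv$ the Riemannian volume, and $(r,\sigma)\in(0,\infty)\times\mathbb{S}^{N-1}$ geodesic polar coordinates around $o$, in which the metric is $dr^2+\sinh^2 r\,d\omega^2$. Put $$\Delta_r u=\frac{\partial^2u}{\partial r^2}+(N-1)\coth r\,\frac{\partial u}{\partial r},\qquad \nabla_r u=\Big(\frac{\partial u}{\partial r},0\Big),$$ and $\nabla_r^k=\Delta_r^{k/2}$ if $k$ is even, $\nabla_r^k=\nabla_r\Delta_r^{(k-1)/2}$ if $k$ is odd. Then there exist $k$ positive constants $C^1_{k,0},\dots,C^k_{k,0}$ (depending only on $k$ and $N$) such that for every real-valued $u\in C_c^\infty(\mathbb{H}^N\setminus\{o\})$ all the integrals below converge and $$\int_{\mathbb{H}^N}|\nabla_r^k u|^2\,dv-\Big(\frac{N-1}{2}\Big)^{2k}\int_{\mathbb{H}^N}u^2\,dv\ \ge\ \sum_{i=1}^k C^i_{k,0}\int_{\mathbb{H}^N}\frac{u^2}{r^{2i}}\,dv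 .$$ Moreover, the constants can be chosen such that the leading ones are $$C^k_{k,0}=\begin{cases}\Big(\dfrac{N-4}{2^{2m}}\Big)^2\displaystyle\prod_{j=1}^{m-1}(N+4j)^2(N-4j-4)^2 & \text{if } k=2m,\\[2mm] \dfrac{1}{2^{4m+2}}\displaystyle\prod_{j=1}^{m}(N+4j-2)^2(N-4j-2)^2 & \text{if } k=2m+1,\end{cases}$$ and $$C^1_{k,0}=\begin{cases}\dfrac{N(N-1)}{2^{4m}}\displaystyle\sum_{j=1}^{m}(N-1)^{4m-2j-2} & \text{if } k=2m,\\[2mm] \dfrac{N(N-1)}{2^{4m+2}}\displaystyle\sum_{j=1}^{m}(N-1)^{2m+2j-2}+\dfrac{(N-1)^{2m}}{2^{4m+2}} & \text{if } k=2m+1,\end{cases}$$ where empty sums are $0$ and empty products are $1$. -/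

import Mathlib

open MeasureTheory

/-! Hyperbolic space `ℍᴺ` of curvature `-1` in the Poincaré ball model: the unit ball of `ℝᴺ`
with the metric `g_x = λ(x)² ⟨·,·⟩`, where `λ(x) = 2 / (1 - |x|²)`. The pole `o` is the centre `0`. -/

namespace HypBall

noncomputable section

/-- The conformal factor `λ(x) = 2 / (1 - |x|²)` of the Poincaré metric. -/
def conf {N : ℕ} (x : EuclideanSpace ℝ (Fin N)) : ℝ := 2 / (1 - ‖x‖ ^ 2)

/-- The length of a tangent vector `v` at the point `x`, for the Poincaré metric. -/
def tangentNorm {N : ℕ} (x v : EuclideanSpace ℝ (Fin N)) : ℝ := conf x * ‖v‖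

/-- The geodesic distance of the Poincaré ball. -/
def geoDist {N : ℕ} (x y : EuclideanSpace ℝ (Fin N)) : ℝ :=
  Real.arcosh (1 + 2 * ‖x - y‖ ^ 2 / ((1 - ‖x‖ ^ 2) * (1 - ‖y‖ ^ 2)))

/-- `r(x)`, the geodesic distance from the pole. -/
def rad {N : ℕ} (x : EuclideanSpace ℝ (Fin N)) : ℝ := geoDist x 0

/-- The Riemannian volume measure of the Poincaré metric, with density `λᴺ` on the unit ball. -/
def vol (N : ℕ) : Measure (EuclideanSpace ℝ (Fin N)) :=
  (volume.restrict (Metric.ball 0 1)).withDensity fun x => ENNReal.ofReal (conf x ^ N)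

/-- Geodesic polar coordinates: the point with coordinates `(t, σ)`, for `t > 0` and `σ` a unit
vector; `t ↦ polar t σ` is the unit speed geodesic that leaves the pole in the direction `σ`. -/
def polar {N : ℕ} (t : ℝ) (σ : EuclideanSpace ℝ (Fin N)) : EuclideanSpace ℝ (Fin N) :=
  Real.tanh (t / 2) • σ

/-- The first polar coordinate of `polar t σ` is `t`. -/
theorem rad_polar {N : ℕ} {t : ℝ} (ht : 0 ≤ t) {σ : EuclideanSpace ℝ (Fin N)} (hσ : ‖σ‖ = 1) :
    rad (polar t σ) = t := by
  have hc : 0 < Real.cosh (t / 2) := Real.cosh_pos _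
  have hsq := Real.cosh_sq (t / 2)
  have hcosh : Real.cosh t = Real.cosh (t / 2) ^ 2 + Real.sinh (t / 2) ^ 2 := by
    rw [← Real.cosh_two_mul]
    congr 1
    ring
  have hn : ‖polar t σ‖ ^ 2 = Real.tanh (t / 2) ^ 2 := by
    simp [polar, norm_smul, hσ]
  have h1 : 1 - Real.tanh (t / 2) ^ 2 = 1 / Real.cosh (t / 2) ^ 2 := by
    rw [Real.tanh_eq_sinh_div_cosh]
    field_simp
    linarith
  have key : 1 + 2 * ‖polar t σ - 0‖ ^ 2 /
      ((1 - ‖polar t σ‖ ^ 2) * (1 - ‖(0 : EuclideanSpace ℝ (Fin N))‖ ^ 2)) = Real.cosh t := by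
    rw [sub_zero, hn, h1, hcosh, Real.tanh_eq_sinh_div_cosh]
    simp only [norm_zero]
    field_simp
    linarith
  rw [rad, geoDist, key, Real.arcosh_cosh ht]

/-- `∂u/∂r` at the point `x = (r(x), x/|x|)`, in geodesic polar coordinates. -/
def dr {N : ℕ} (u : EuclideanSpace ℝ (Fin N) → ℝ) (x : EuclideanSpace ℝ (Fin N)) : ℝ :=
  deriv (fun t : ℝ => u (polar t (‖x‖⁻¹ • x))) (rad x)

/-- The radial gradient: the tangent vector `(∂u/∂r) e_r`, with
`e_r = λ(x)⁻¹ x/|x|` the outward radial vector that has unit length in the Poincaré metric. -/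
def radGrad {N : ℕ} (u : EuclideanSpace ℝ (Fin N) → ℝ) (x : EuclideanSpace ℝ (Fin N)) :
    EuclideanSpace ℝ (Fin N) :=
  dr u x • (conf x)⁻¹ • ‖x‖⁻¹ • x

/-- The radial Laplacian `∂²u/∂r² + (N - 1) coth r ∂u/∂r`. -/
def radLap {N : ℕ} (u : EuclideanSpace ℝ (Fin N) → ℝ) (x : EuclideanSpace ℝ (Fin N)) : ℝ :=
  dr (dr u) x + ((N : ℝ) - 1) * (Real.cosh (rad x) / Real.sinh (rad x)) * dr u x

/-- `|∇_r^k u|`: the absolute value of `Δ_r^{k/2} u` for even `k`, and the length of the tangent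
vector `∇_r Δ_r^{(k-1)/2} u` for odd `k`. -/
def absRadNabla {N : ℕ} (k : ℕ) (u : EuclideanSpace ℝ (Fin N) → ℝ)
    (x : EuclideanSpace ℝ (Fin N)) : ℝ :=
  if Even k then |(radLap^[k / 2] u) x| else tangentNorm x (radGrad (radLap^[(k - 1) / 2] u) x)

/-- `C_c^∞(ℍᴺ ∖ {o})`: smooth functions with compact support in the punctured unit ball
(extended by zero to `ℝᴺ`). -/
structure IsTest {N : ℕ} (u : EuclideanSpace ℝ (Fin N) → ℝ) : Prop where
  smooth : ContDiff ℝ (⊤ : ℕ∞) u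
  compact : HasCompactSupport u
  support : tsupport u ⊆ Metric.ball 0 1 \ {0}

end

end HypBall

/-!
Let `n = N - 1`. In geodesic polar coordinates the volume is `sinhⁿ t dt dσ`, and the operators
`∇_r`, `Δ_r` act on each ray separately, as `f ↦ f'` and `f ↦ f'' + n coth t f'`. So the theorem is
an inequality for smooth compactly supported functions `f` on `(0, ∞)` (`radial_inequality`), which
is integrated over the sphere of directions (`ShellTest.sum_le_of_radial`,
`integral_vol_eq_integral_polar`).

The one-dimensional inequality rests on one Hardy inequality (`hardy`), for the weights
`t^(-2a) sinh^ν t` with `ν` an integer of either sign. It comes from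
`0 ≤ ∫ (f' + φ f)² t^(-2a) sinh^ν t dt` with `φ = (ν/2) coth t - (a + 1/2)/t`. With `ν = n` it bounds
`∫ f'² t^(-2a) sinhⁿ` from below by integrals of `f²`. With `ν = -n`, applied to `sinhⁿ f'`, whose
derivative is `sinhⁿ Δf`, it bounds `∫ (Δf)² t^(-2a) sinhⁿ` from below by integrals of `f'²`. The
potentials are compared with powers of `t` through `sinh⁻² t ≥ t⁻² - 1/3` and
`t⁻² ≤ coth t / t ≤ t⁻² + 1/3`. Writing `E a f` for `∫ f² t^(-2a) sinhⁿ t dt`, the two steps together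
give

* `E 0 (Δf) ≥ (n/2)⁴ E 0 f + (N n / 16) E 1 f + ((N - 4)² / 16) E 2 f` (`poincare_rellich`),
* `E a (Δf) ≥ (n²/16) E a f + B E (a+1) f + A E (a+2) f` for `N > 2a + 4`, with some `B > 0` and with
  `A = ((N + 2a) (N - 4 - 2a) / 4)²` (`weighted_rellich`).

Iterating these inequalities, and starting from the Poincaré–Hardy inequality when `k` is odd,
yields the constants: the coefficient of the highest singularity `t^(-2k)` collects the factors `A`,
the coefficient of `t⁻²` collects the Poincaré factors `(n/2)⁴` and `n²/16`, and all coefficients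
in between are positive because each step spreads over consecutive exponents.
-/

namespace HypBall

open Set Filter Topology
open scoped ContDiff

/-! ### Elementary bounds for hyperbolic functions -/

theorem sinh_le_mul_cosh {t : ℝ} (ht : 0 ≤ t) : Real.sinh t ≤ t * Real.cosh t := by
  have hd : ∀ x : ℝ, HasDerivAt (fun x => x * Real.cosh x - Real.sinh x) (x * Real.sinh x) x := by
    intro x
    have := ((hasDerivAt_id x).mul (Real.hasDerivAt_cosh x)).sub (Real.hasDerivAt_sinh x)
    refine this.congr_deriv ?_
    simp
  have hm : MonotoneOn (fun x => x * Real.cosh x - Real.sinh x) (Ici 0) := by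
    refine monotoneOn_of_hasDerivWithinAt_nonneg (convex_Ici 0)
      (fun x _ => (hd x).continuousAt.continuousWithinAt) (fun x _ => (hd x).hasDerivWithinAt) ?_
    intro x hx
    rw [interior_Ici] at hx
    exact mul_nonneg (le_of_lt hx) (Real.sinh_nonneg_iff.2 (le_of_lt hx))
  have := hm (mem_Ici.2 le_rfl) ht ht
  simp at this
  linarith

theorem mul_cosh_le {t : ℝ} (ht : 0 ≤ t) :
    3 * (t * Real.cosh t) ≤ (3 + t ^ 2) * Real.sinh t := by
  have hd : ∀ x : ℝ, HasDerivAt (fun x => (3 + x ^ 2) * Real.sinh x - 3 * (x * Real.cosh x))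
      (x * (x * Real.cosh x - Real.sinh x)) x := by
    intro x
    have := ((((hasDerivAt_id x).pow 2).const_add 3).mul (Real.hasDerivAt_sinh x)).sub
      (((hasDerivAt_id x).mul (Real.hasDerivAt_cosh x)).const_mul 3)
    refine this.congr_deriv ?_
    simp
    ring
  have hm : MonotoneOn (fun x => (3 + x ^ 2) * Real.sinh x - 3 * (x * Real.cosh x)) (Ici 0) := by
    refine monotoneOn_of_hasDerivWithinAt_nonneg (convex_Ici 0)
      (fun x _ => (hd x).continuousAt.continuousWithinAt) (fun x _ => (hd x).hasDerivWithinAt) ?_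
    intro x hx
    rw [interior_Ici] at hx
    exact mul_nonneg (le_of_lt hx) (sub_nonneg.2 (sinh_le_mul_cosh (le_of_lt hx)))
  have := hm (mem_Ici.2 le_rfl) ht ht
  simp at this
  linarith

/-- `sinh t / t ≤ e^(t²/6)`: the quotient of the two sides decreases, from its limit `1` at `0`. -/
theorem sinh_le_mul_exp {t : ℝ} (ht : 0 < t) : Real.sinh t ≤ t * Real.exp (t ^ 2 / 6) := by
  have key : ∀ s ∈ Ioo 0 t, Real.sinh t * Real.exp (-(t ^ 2 / 6)) / t ≤
      Real.sinh s * Real.exp (-(s ^ 2 / 6)) / s := by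
    intro s hs
    have hd : ∀ x : ℝ, x ≠ 0 → HasDerivAt (fun x => Real.sinh x * Real.exp (-(x ^ 2 / 6)) / x)
        (Real.exp (-(x ^ 2 / 6)) * (3 * (x * Real.cosh x) - (3 + x ^ 2) * Real.sinh x)
          / (3 * x ^ 2)) x := by
      intro x hx
      have := ((Real.hasDerivAt_sinh x).mul
        (((((hasDerivAt_id x).pow 2).div_const 6).neg).exp)).div (hasDerivAt_id x) hx
      refine this.congr_deriv ?_
      simp
      field_simp
      ring
    have hm : AntitoneOn (fun x => Real.sinh x * Real.exp (-(x ^ 2 / 6)) / x) (Ioi 0) := by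
      refine antitoneOn_of_hasDerivWithinAt_nonpos (convex_Ioi 0)
        (fun x hx => (hd x (ne_of_gt hx)).continuousAt.continuousWithinAt)
        (fun x hx => (hd x ?_).hasDerivWithinAt) ?_
      · rw [interior_Ioi] at hx
        exact ne_of_gt hx
      · intro x hx
        rw [interior_Ioi] at hx
        refine div_nonpos_of_nonpos_of_nonneg (mul_nonpos_of_nonneg_of_nonpos (Real.exp_pos _).le
          (sub_nonpos.2 (mul_cosh_le (le_of_lt hx)))) (by positivity)
    exact hm hs.1 ht hs.2.le
  have hlim : Tendsto (fun s : ℝ => Real.sinh s * Real.exp (-(s ^ 2 / 6)) / s) (𝓝[>] 0) (𝓝 1) := by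
    have h1 : HasDerivAt (fun x => Real.sinh x * Real.exp (-(x ^ 2 / 6))) 1 0 := by
      have := (Real.hasDerivAt_sinh 0).mul
        (((((hasDerivAt_id (0 : ℝ)).pow 2).div_const 6).neg).exp)
      refine this.congr_deriv ?_
      simp
    have h2 := h1.tendsto_slope_zero_right
    refine h2.congr fun s => ?_
    simp
    ring
  have h3 : Real.sinh t * Real.exp (-(t ^ 2 / 6)) / t ≤ 1 := by
    refine ge_of_tendsto hlim ?_
    filter_upwards [Ioo_mem_nhdsGT ht] with s hs using key s hs
  rw [div_le_one ht, Real.exp_neg, ← div_eq_mul_inv, div_le_iff₀ (Real.exp_pos _)] at h3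
  exact h3

/-- Obtained from the square of `sinh t ≤ t e^(t²/6)` and `1 - s ≤ e^(-s)`. -/
theorem inv_sq_sub_le_inv_sinh_sq {t : ℝ} (ht : 0 < t) :
    1 / t ^ 2 - 1 / 3 ≤ 1 / Real.sinh t ^ 2 := by
  have hs : 0 < Real.sinh t := Real.sinh_pos_iff.2 ht
  have h1 : Real.sinh t ^ 2 ≤ t ^ 2 * Real.exp (t ^ 2 / 3) := by
    have := pow_le_pow_left₀ hs.le (sinh_le_mul_exp ht) 2
    rw [mul_pow, ← Real.exp_nat_mul] at this
    rwa [show ((2 : ℕ) : ℝ) * (t ^ 2 / 6) = t ^ 2 / 3 by push_cast; ring] at this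
  have h2 : 1 - t ^ 2 / 3 ≤ Real.exp (-(t ^ 2 / 3)) := by
    have := Real.add_one_le_exp (-(t ^ 2 / 3))
    linarith
  calc 1 / t ^ 2 - 1 / 3 = (1 - t ^ 2 / 3) / t ^ 2 := by field_simp
    _ ≤ Real.exp (-(t ^ 2 / 3)) / t ^ 2 := by gcongr
    _ = 1 / (t ^ 2 * Real.exp (t ^ 2 / 3)) := by rw [Real.exp_neg]; field_simp
    _ ≤ 1 / Real.sinh t ^ 2 := by gcongr

theorem inv_sq_le_coth_div {t : ℝ} (ht : 0 < t) :
    1 / t ^ 2 ≤ Real.cosh t / Real.sinh t / t := by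
  have hs : 0 < Real.sinh t := Real.sinh_pos_iff.2 ht
  rw [div_div, div_le_div_iff₀ (by positivity) (by positivity)]
  nlinarith [sinh_le_mul_cosh ht.le]

theorem coth_div_le {t : ℝ} (ht : 0 < t) :
    Real.cosh t / Real.sinh t / t ≤ 1 / t ^ 2 + 1 / 3 := by
  have hs : 0 < Real.sinh t := Real.sinh_pos_iff.2 ht
  have : 1 / t ^ 2 + 1 / 3 = (3 + t ^ 2) / (3 * t ^ 2) := by field_simp
  rw [this, div_div, div_le_div_iff₀ (by positivity) (by positivity)]
  nlinarith [mul_cosh_le ht.le]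

/-! ### Radial test functions -/

/-- A smooth function on `(0, ∞)` that vanishes off a compact interval `[a, b] ⊆ (0, ∞)`.
It is the restriction to a ray from the pole of a test function on the punctured space;
values at `t ≤ 0` are irrelevant. -/
structure RadialTest (f : ℝ → ℝ) : Prop where
  smooth : ContDiffOn ℝ ∞ f (Ioi 0)
  support : ∃ a b : ℝ, 0 < a ∧ ∀ t, 0 < t → t ∉ Icc a b → f t = 0

/-- The radial Laplacian `f'' + n coth f'` of the hyperbolic space of dimension `n + 1`. -/
noncomputable def lap (n : ℝ) (f : ℝ → ℝ) (t : ℝ) : ℝ :=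
  deriv (deriv f) t + n * (Real.cosh t / Real.sinh t) * deriv f t

theorem contDiffOn_coth : ContDiffOn ℝ ∞ (fun t => Real.cosh t / Real.sinh t) (Ioi 0) :=
  Real.contDiff_cosh.contDiffOn.div Real.contDiff_sinh.contDiffOn
    fun _ ht => (Real.sinh_pos_iff.2 ht).ne'

namespace RadialTest

variable {f : ℝ → ℝ}

theorem hasDerivAt (hf : RadialTest f) {t : ℝ} (ht : 0 < t) : HasDerivAt f (deriv f t) t :=
  ((hf.smooth.contDiffAt (Ioi_mem_nhds ht)).differentiableAt (by simp)).hasDerivAt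

theorem deriv (hf : RadialTest f) : RadialTest (deriv f) where
  smooth := hf.smooth.deriv_of_isOpen isOpen_Ioi (by simp)
  support := by
    obtain ⟨a, b, ha, h⟩ := hf.support
    refine ⟨a, b, ha, fun t ht htab => ?_⟩
    have : f =ᶠ[𝓝 t] fun _ => 0 := by
      filter_upwards [Ioi_mem_nhds ht, isClosed_Icc.isOpen_compl.mem_nhds htab] with s hs hs'
        using h s hs hs'
    rw [this.deriv_eq, deriv_const]

theorem smooth_mul (hf : RadialTest f) {h : ℝ → ℝ} (hh : ContDiffOn ℝ ∞ h (Ioi 0)) :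
    RadialTest (fun t => h t * f t) where
  smooth := hh.mul hf.smooth
  support := by
    obtain ⟨a, b, ha, h⟩ := hf.support
    exact ⟨a, b, ha, fun t ht htab => by simp [h t ht htab]⟩

theorem lap (hf : RadialTest f) (n : ℝ) : RadialTest (lap n f) where
  smooth := hf.deriv.deriv.smooth.add ((contDiffOn_const.mul contDiffOn_coth).mul hf.deriv.smooth)
  support := by
    obtain ⟨a, b, ha, h⟩ := hf.deriv.support
    obtain ⟨a', b', ha', h'⟩ := hf.deriv.deriv.support
    refine ⟨min a a', max b b', lt_min ha ha', fun t ht htab => ?_⟩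
    have h1 : t ∉ Icc a b := fun hx => htab ⟨(min_le_left _ _).trans hx.1,
      hx.2.trans (le_max_left _ _)⟩
    have h2 : t ∉ Icc a' b' := fun hx => htab ⟨(min_le_right _ _).trans hx.1,
      hx.2.trans (le_max_right _ _)⟩
    simp [HypBall.lap, h t ht h1, h' t ht h2]

theorem lap_iterate (hf : RadialTest f) (n : ℝ) (m : ℕ) : RadialTest ((HypBall.lap n)^[m] f) := by
  induction m with
  | zero => exact hf
  | succ m ih =>
    rw [Function.iterate_succ_apply']
    exact ih.lap n

theorem integrableOn_mul (hf : RadialTest f) {h : ℝ → ℝ} (hh : ContinuousOn h (Ioi 0)) :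
    IntegrableOn (fun t => f t * h t) (Ioi 0) := by
  obtain ⟨a, b, ha, hab⟩ := hf.support
  have hsub : Icc a b ⊆ Ioi 0 := fun x hx => ha.trans_le hx.1
  have hc : IntegrableOn (fun t => f t * h t) (Icc a b) :=
    ((hf.smooth.continuousOn.mul hh).mono hsub).integrableOn_compact isCompact_Icc
  exact hc.of_forall_sdiff_eq_zero measurableSet_Ioi fun t ht => by simp [hab t ht.1 ht.2]

/-- The fundamental theorem of calculus without boundary terms. -/
theorem integral_deriv (hf : RadialTest f) : ∫ t in Ioi 0, _root_.deriv f t = 0 := by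
  obtain ⟨a, b, ha, hab⟩ := hf.support
  have hev : ∀ t : ℝ, 0 < t → (Ioi 0).indicator f =ᶠ[𝓝 t] f := fun t ht => by
    filter_upwards [Ioi_mem_nhds ht] with s hs using indicator_of_mem hs f
  have hint : IntegrableOn (_root_.deriv f) (Ioi 0) := by
    simpa using hf.deriv.integrableOn_mul (continuousOn_const (c := (1 : ℝ)))
  have h := integral_Ioi_of_hasDerivAt_of_tendsto (f := (Ioi 0).indicator f) (a := 0) (m := 0)
    ?_ (fun t ht => (hf.hasDerivAt ht).congr_of_eventuallyEq (hev t ht)) hint ?_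
  · simpa using h
  · refine ContinuousAt.continuousWithinAt ?_
    have : (Ioi 0).indicator f =ᶠ[𝓝 0] fun _ => 0 := by
      filter_upwards [Iio_mem_nhds ha] with s hs
      by_cases hs0 : 0 < s
      · rw [indicator_of_mem (mem_Ioi.2 hs0)]
        exact hab s hs0 fun hx => absurd hx.1 (not_le.2 hs)
      · exact indicator_of_notMem (by simpa using hs0) f
    exact continuousAt_const.congr this.symm
  · refine tendsto_const_nhds.congr' ?_
    filter_upwards [Ioi_mem_atTop (max b 0)] with s hs
    have hs' : max b 0 < s := hs
    rw [indicator_of_mem (mem_Ioi.2 ((le_max_right _ _).trans_lt hs'))]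
    exact (hab s ((le_max_right _ _).trans_lt hs') fun hx =>
      absurd hx.2 (not_le.2 ((le_max_left _ _).trans_lt hs'))).symm

end RadialTest

/-! ### Weighted one-dimensional Hardy inequalities -/

/-- The weight `t^(-2a) sinh^ν t`. -/
noncomputable def wt (a : ℕ) (ν : ℤ) (t : ℝ) : ℝ := (t ^ (2 * a))⁻¹ * Real.sinh t ^ ν

theorem wt_pos (a : ℕ) (ν : ℤ) {t : ℝ} (ht : 0 < t) : 0 < wt a ν t :=
  mul_pos (by positivity) (zpow_pos (Real.sinh_pos_iff.2 ht) ν)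

theorem contDiffOn_sinh_zpow (ν : ℤ) : ContDiffOn ℝ ∞ (fun t => Real.sinh t ^ ν) (Ioi 0) := by
  intro t ht
  have hs : Real.sinh t ≠ 0 := (Real.sinh_pos_iff.2 ht).ne'
  rcases ν with k | k
  · simpa using (Real.contDiff_sinh.pow k).contDiffWithinAt
  · simp only [zpow_negSucc]
    exact ((Real.contDiff_sinh.pow _).contDiffAt.inv (pow_ne_zero _ hs)).contDiffWithinAt

theorem contDiffOn_wt (a : ℕ) (ν : ℤ) : ContDiffOn ℝ ∞ (wt a ν) (Ioi 0) :=
  ((contDiff_id.pow (2 * a)).contDiffOn.inv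
    fun _ ht => pow_ne_zero _ (ne_of_gt (mem_Ioi.1 ht))).mul (contDiffOn_sinh_zpow ν)

theorem hasDerivAt_wt (a : ℕ) (ν : ℤ) {t : ℝ} (ht : 0 < t) :
    HasDerivAt (wt a ν) (wt a ν t * (ν * (Real.cosh t / Real.sinh t) - 2 * a / t)) t := by
  have hs : Real.sinh t ≠ 0 := (Real.sinh_pos_iff.2 ht).ne'
  have h1 : HasDerivAt (fun t : ℝ => (t ^ (2 * a))⁻¹) (-(2 * a / t) * (t ^ (2 * a))⁻¹) t := by
    have := (hasDerivAt_zpow (-(2 * a : ℤ)) t (Or.inl ht.ne'))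
    have e : (fun t : ℝ => t ^ (-(2 * a : ℤ))) = fun t : ℝ => (t ^ (2 * a))⁻¹ := by
      ext s
      rw [zpow_neg]
      norm_cast
    rw [e, zpow_sub_one₀ ht.ne', zpow_neg] at this
    refine this.congr_deriv ?_
    push_cast
    have e2 : t ^ (2 * (a : ℤ)) = t ^ (2 * a) := by norm_cast
    rw [e2]
    field_simp
  have h2 : HasDerivAt (fun t => Real.sinh t ^ ν)
      (ν * (Real.cosh t / Real.sinh t) * Real.sinh t ^ ν) t := by
    have := (hasDerivAt_zpow ν (Real.sinh t) (Or.inl hs)).comp t (Real.hasDerivAt_sinh t)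
    refine this.congr_deriv ?_
    rw [zpow_sub_one₀ hs]
    field_simp
  refine (h1.mul h2).congr_deriv ?_
  rw [wt]
  ring

/-- The potential of the Hardy inequality for the weight `W = t^(-2a) sinh^ν t`. It equals
`(φ W)' / W - φ ^ 2` for `φ = (ν/2) coth t - (a + 1/2)/t`. -/
noncomputable def hardyPot (a : ℕ) (ν : ℤ) (t : ℝ) : ℝ :=
  (ν : ℝ) ^ 2 / 4 + ((ν : ℝ) ^ 2 / 4 - ν / 2) * (1 / Real.sinh t ^ 2)
    - a * ν * (Real.cosh t / Real.sinh t / t) + ((a : ℝ) + 1 / 2) ^ 2 * (1 / t ^ 2)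

theorem integrableOn_sq_mul_hardyPot {f : ℝ → ℝ} (hf : RadialTest f) (a : ℕ) (ν : ℤ) :
    IntegrableOn (fun t => f t ^ 2 * (hardyPot a ν t * wt a ν t)) (Ioi 0) := by
  have hc : ContinuousOn (fun t => hardyPot a ν t * wt a ν t) (Ioi 0) := by
    refine ContinuousOn.mul ?_ (contDiffOn_wt a ν).continuousOn
    have hs : ∀ t ∈ Ioi (0 : ℝ), Real.sinh t ≠ 0 := fun t ht => (Real.sinh_pos_iff.2 ht).ne'
    have ht0 : ∀ t ∈ Ioi (0 : ℝ), t ≠ 0 := fun t ht => ne_of_gt ht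
    have h1 : ContinuousOn (fun t => 1 / Real.sinh t ^ 2) (Ioi 0) :=
      continuousOn_const.div (Real.continuous_sinh.pow 2).continuousOn
        fun t ht => pow_ne_zero _ (hs t ht)
    have h2 : ContinuousOn (fun t : ℝ => 1 / t ^ 2) (Ioi 0) :=
      continuousOn_const.div (continuous_pow 2).continuousOn fun t ht => pow_ne_zero _ (ht0 t ht)
    have h3 : ContinuousOn (fun t => Real.cosh t / Real.sinh t / t) (Ioi 0) :=
      contDiffOn_coth.continuousOn.div continuousOn_id ht0
    exact ((continuousOn_const.add (continuousOn_const.mul h1)).sub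
      (continuousOn_const.mul h3)).add (continuousOn_const.mul h2)
  simpa [pow_two, mul_assoc] using (hf.smooth_mul hf.smooth).integrableOn_mul hc

/-- Hardy's inequality for the weight `t^(-2a) sinh^ν t`: the square of
`f' + φ f` with `φ = (ν/2) coth t - (a + 1/2)/t` is expanded and the mixed term is
integrated by parts. -/
theorem hardy {f : ℝ → ℝ} (hf : RadialTest f) (a : ℕ) (ν : ℤ) :
    ∫ t in Ioi 0, f t ^ 2 * (hardyPot a ν t * wt a ν t)
      ≤ ∫ t in Ioi 0, deriv f t ^ 2 * wt a ν t := by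
  set φ : ℝ → ℝ := fun t => ν / 2 * (Real.cosh t / Real.sinh t) - (a + 1 / 2) / t with hφ
  have hφs : ContDiffOn ℝ ∞ φ (Ioi 0) :=
    (contDiffOn_const.mul contDiffOn_coth).sub
      (contDiffOn_const.div contDiffOn_id fun _ ht => ne_of_gt ht)
  have hg : RadialTest fun t => (φ t * wt a ν t * f t) * f t :=
    hf.smooth_mul ((hφs.mul (contDiffOn_wt a ν)).mul hf.smooth)
  have h0 := hg.integral_deriv
  have i1 := integrableOn_sq_mul_hardyPot hf a ν
  have i2 : IntegrableOn (fun t => deriv f t ^ 2 * wt a ν t) (Ioi 0) := by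
    simpa [pow_two] using
      (hf.deriv.smooth_mul hf.deriv.smooth).integrableOn_mul (contDiffOn_wt a ν).continuousOn
  have i3 : IntegrableOn (deriv fun t => (φ t * wt a ν t * f t) * f t) (Ioi 0) := by
    simpa using hg.deriv.integrableOn_mul (continuousOn_const (c := (1 : ℝ)))
  suffices h : _ ≤ (∫ t in Ioi 0, deriv f t ^ 2 * wt a ν t)
      + ∫ t in Ioi 0, deriv (fun t => (φ t * wt a ν t * f t) * f t) t by rwa [h0, add_zero] at h
  rw [← integral_add i2 i3]
  refine setIntegral_mono_on i1 (i2.add i3) measurableSet_Ioi fun t ht => ?_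
  have ht : 0 < t := ht
  have hs : Real.sinh t ≠ 0 := (Real.sinh_pos_iff.2 ht).ne'
  have hφd : HasDerivAt φ (-(ν / 2) * (1 / Real.sinh t ^ 2) + (a + 1 / 2) * (1 / t ^ 2)) t := by
    have := (((Real.hasDerivAt_cosh t).div (Real.hasDerivAt_sinh t) hs).const_mul (ν / 2 : ℝ)).sub
      ((hasDerivAt_const t ((a : ℝ) + 1 / 2)).div (hasDerivAt_id t) ht.ne')
    refine this.congr_deriv ?_
    have e : Real.sinh t * Real.sinh t - Real.cosh t * Real.cosh t = -1 := by
      nlinarith [Real.cosh_sq t]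
    rw [e]
    simp
    ring
  have hd := (((hφd.mul (hasDerivAt_wt a ν ht)).mul (hf.hasDerivAt ht)).mul
    (hf.hasDerivAt ht)).deriv
  have hd' : deriv (fun t => (φ t * wt a ν t * f t) * f t) t = _ := hd
  have hcoth : (Real.cosh t / Real.sinh t) ^ 2 = 1 + 1 / Real.sinh t ^ 2 := by
    rw [div_pow, Real.cosh_sq]
    field_simp
  have hφ2 : φ t ^ 2 = ν ^ 2 / 4 * (1 + 1 / Real.sinh t ^ 2)
      - ν * (a + 1 / 2) * (Real.cosh t / Real.sinh t / t) + (a + 1 / 2) ^ 2 * (1 / t ^ 2) := by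
    rw [← hcoth, hφ]
    field_simp
    ring
  have hφ1 : φ t * (ν * (Real.cosh t / Real.sinh t) - 2 * a / t) =
      ν ^ 2 / 2 * (1 + 1 / Real.sinh t ^ 2)
      - ν * (2 * a + 1 / 2) * (Real.cosh t / Real.sinh t / t) + (2 * a + 1) * a * (1 / t ^ 2) := by
    rw [← hcoth, hφ]
    field_simp
    ring
  have hsq : 0 ≤ (deriv f t + φ t * f t) ^ 2 * wt a ν t :=
    mul_nonneg (sq_nonneg _) (wt_pos a ν ht).le
  rw [hd', ← sub_nonneg]
  refine hsq.trans_eq ?_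
  simp only [Pi.mul_apply, hardyPot]
  clear_value φ
  linear_combination (wt a ν t * f t ^ 2) * hφ2 - (wt a ν t * f t ^ 2) * hφ1

/-- The weighted square integral `∫ f² t^(-2a) sinh^ν t dt` over `(0, ∞)`. -/
noncomputable def energy (a : ℕ) (ν : ℤ) (f : ℝ → ℝ) : ℝ := ∫ t in Ioi 0, f t ^ 2 * wt a ν t

theorem energy_nonneg (a : ℕ) (ν : ℤ) (f : ℝ → ℝ) : 0 ≤ energy a ν f :=
  setIntegral_nonneg measurableSet_Ioi fun _ ht => mul_nonneg (sq_nonneg _) (wt_pos a ν ht).le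

theorem RadialTest.integrableOn_sq_mul_wt {f : ℝ → ℝ} (hf : RadialTest f) (a : ℕ) (ν : ℤ) :
    IntegrableOn (fun t => f t ^ 2 * wt a ν t) (Ioi 0) := by
  simpa [pow_two] using (hf.smooth_mul hf.smooth).integrableOn_mul (contDiffOn_wt a ν).continuousOn

theorem wt_succ (a : ℕ) (ν : ℤ) {t : ℝ} (ht : 0 < t) : wt (a + 1) ν t = 1 / t ^ 2 * wt a ν t := by
  rw [wt, wt, show 2 * (a + 1) = 2 * a + 2 by ring, pow_add]
  field_simp

theorem hardy_of_le {f : ℝ → ℝ} (hf : RadialTest f) {a : ℕ} {ν : ℤ} {p q : ℝ}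
    (h : ∀ t, 0 < t → p + q * (1 / t ^ 2) ≤ hardyPot a ν t) :
    p * energy a ν f + q * energy (a + 1) ν f ≤ energy a ν (deriv f) := by
  refine le_trans ?_ (hardy hf a ν)
  have i0 := hf.integrableOn_sq_mul_wt a ν
  have i1 := hf.integrableOn_sq_mul_wt (a + 1) ν
  rw [energy, energy, ← integral_const_mul, ← integral_const_mul,
    ← integral_add (i0.const_mul p) (i1.const_mul q)]
  refine setIntegral_mono_on ((i0.const_mul p).add (i1.const_mul q))
    (integrableOn_sq_mul_hardyPot hf a ν) measurableSet_Ioi fun t ht => ?_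
  have hw := mul_le_mul_of_nonneg_right (h t ht)
    (mul_nonneg (sq_nonneg (f t)) (wt_pos a ν ht).le)
  rw [wt_succ a ν ht]
  linarith

theorem energy_neg_sinh_mul (a n : ℕ) (g : ℝ → ℝ) :
    energy a (-n) (fun t => Real.sinh t ^ (n : ℤ) * g t) = energy a n g := by
  refine setIntegral_congr_fun measurableSet_Ioi fun t ht => ?_
  have hs : Real.sinh t ≠ 0 := (Real.sinh_pos_iff.2 ht).ne'
  simp only [wt, zpow_neg, zpow_natCast]
  field_simp

/-- The radial Laplacian in divergence form: `(sinhⁿ f')' = sinhⁿ Δf`. -/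
theorem deriv_sinh_mul_deriv {f : ℝ → ℝ} (hf : RadialTest f) (n : ℕ) {t : ℝ} (ht : 0 < t) :
    deriv (fun t => Real.sinh t ^ (n : ℤ) * deriv f t) t = Real.sinh t ^ (n : ℤ) * lap n f t := by
  have hs : Real.sinh t ≠ 0 := (Real.sinh_pos_iff.2 ht).ne'
  have h := (((hasDerivAt_zpow (n : ℤ) (Real.sinh t) (Or.inl hs)).comp t
    (Real.hasDerivAt_sinh t)).mul (hf.deriv.hasDerivAt ht)).deriv
  refine Eq.trans h ?_
  rw [zpow_sub_one₀ hs, lap]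
  simp only [Function.comp, Int.cast_natCast]
  field_simp
  ring

/-- Hardy's inequality for `sinhⁿ f'` and the weight `t^(-2a) sinh^(-n) t`, in terms of the
radial Laplacian. -/
theorem lap_hardy_of_le {f : ℝ → ℝ} (hf : RadialTest f) {a n : ℕ} {p q : ℝ}
    (h : ∀ t, 0 < t → p + q * (1 / t ^ 2) ≤ hardyPot a (-n) t) :
    p * energy a n (deriv f) + q * energy (a + 1) n (deriv f) ≤ energy a n (lap n f) := by
  have := hardy_of_le (hf.deriv.smooth_mul (contDiffOn_sinh_zpow n)) h
  rw [energy_neg_sinh_mul, energy_neg_sinh_mul] at this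
  refine this.trans_eq ?_
  rw [← energy_neg_sinh_mul a n (lap n f)]
  exact setIntegral_congr_fun measurableSet_Ioi fun t ht => by
    simp only [deriv_sinh_mul_deriv hf n ht]

/-- The Poincaré–Hardy inequality, with the sharp constant `n²/4`. -/
theorem poincare_hardy {f : ℝ → ℝ} (hf : RadialTest f) {n : ℕ} (hn : 2 ≤ n) :
    (n : ℝ) ^ 2 / 4 * energy 0 n f + 1 / 4 * energy 1 n f ≤ energy 0 n (deriv f) := by
  refine hardy_of_le hf fun t ht => ?_
  have hn' : (2 : ℝ) ≤ n := by exact_mod_cast hn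
  have h1 : 0 ≤ ((n : ℝ) ^ 2 / 4 - n / 2) * (1 / Real.sinh t ^ 2) :=
    mul_nonneg (by nlinarith) (by positivity)
  simp only [hardyPot, Int.cast_natCast, Nat.cast_zero]
  linarith

/-- The Hardy inequality with weight `t^(-2a)`: the constant of `t^(-2a-2)` is the
Euclidean one, and the other term is what the curvature adds. -/
theorem weighted_hardy {f : ℝ → ℝ} (hf : RadialTest f) (a : ℕ) {n : ℕ} (hn : 2 ≤ n) :
    (n : ℝ) * (n + 1 - 2 * a) / 6 * energy a n f
      + (((n : ℝ) - 1 - 2 * a) / 2) ^ 2 * energy (a + 1) n f ≤ energy a n (deriv f) := by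
  refine hardy_of_le hf fun t ht => ?_
  have hn' : (2 : ℝ) ≤ n := by exact_mod_cast hn
  have h1 := mul_le_mul_of_nonneg_left (inv_sq_sub_le_inv_sinh_sq ht)
    (show 0 ≤ (n : ℝ) ^ 2 / 4 - n / 2 by nlinarith)
  have h2 := mul_le_mul_of_nonneg_left (coth_div_le ht) (show 0 ≤ (a : ℝ) * n by positivity)
  simp only [hardyPot, Int.cast_natCast]
  nlinarith

/-- The counterpart of `poincare_hardy` one derivative higher. -/
theorem lap_poincare_hardy {f : ℝ → ℝ} (hf : RadialTest f) (n : ℕ) :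
    (n : ℝ) ^ 2 / 4 * energy 0 n (deriv f) + 1 / 4 * energy 1 n (deriv f)
      ≤ energy 0 n (lap n f) := by
  refine lap_hardy_of_le hf fun t ht => ?_
  have h1 : 0 ≤ ((n : ℝ) ^ 2 / 4 + n / 2) * (1 / Real.sinh t ^ 2) := by positivity
  simp only [hardyPot, Int.cast_neg, Int.cast_natCast, Nat.cast_zero]
  linarith

/-- The counterpart of `weighted_hardy` one derivative higher. -/
theorem lap_weighted_hardy {f : ℝ → ℝ} (hf : RadialTest f) (a n : ℕ) :
    (n : ℝ) * (n - 1) / 6 * energy a n (deriv f)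
      + (((n : ℝ) + 1 + 2 * a) / 2) ^ 2 * energy (a + 1) n (deriv f) ≤ energy a n (lap n f) := by
  refine lap_hardy_of_le hf fun t ht => ?_
  have h1 := mul_le_mul_of_nonneg_left (inv_sq_sub_le_inv_sinh_sq ht)
    (show 0 ≤ (n : ℝ) ^ 2 / 4 + n / 2 by positivity)
  have h2 := mul_le_mul_of_nonneg_left (inv_sq_le_coth_div ht) (show 0 ≤ (a : ℝ) * n by positivity)
  simp only [hardyPot, Int.cast_neg, Int.cast_natCast]
  nlinarith

/-! ### Rellich inequalities -/

/-- The unweighted Rellich inequality in dimension `n + 1`. The sharp Poincaré constant is kept,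
and the Hardy remainder `(1/4) ∫ f'² t⁻² sinhⁿ` supplies the term in `t⁻⁴`. -/
theorem poincare_rellich {f : ℝ → ℝ} (hf : RadialTest f) {n : ℕ} (hn : 4 ≤ n) :
    ((n : ℝ) / 2) ^ 4 * energy 0 n f + (n + 1) * n / 16 * energy 1 n f
      + ((n : ℝ) - 3) ^ 2 / 16 * energy 2 n f ≤ energy 0 n (lap n f) := by
  have h0 := lap_poincare_hardy hf n
  have h1 := poincare_hardy hf (show 2 ≤ n by omega)
  have h2 := weighted_hardy hf 1 (show 2 ≤ n by omega)
  have hn' : (4 : ℝ) ≤ n := by exact_mod_cast hn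
  have e1 := energy_nonneg 1 n f
  have h1' := mul_le_mul_of_nonneg_left h1 (show 0 ≤ (n : ℝ) ^ 2 / 4 by positivity)
  have h3 : 0 ≤ ((n : ℝ) * (2 * n - 5) / 48) * energy 1 n f :=
    mul_nonneg (div_nonneg (mul_nonneg (by positivity) (by linarith)) (by norm_num)) e1
  norm_num at h2
  linarith

/-- The leading constant of the weighted Rellich inequality with weight `t^(-2a)`. -/
noncomputable def rellichConst (n a : ℕ) : ℝ :=
  (((n : ℝ) + 1 + 2 * a) * (n - 3 - 2 * a) / 4) ^ 2

/-- The constant of the middle term of the weighted Rellich inequality with weight `t^(-2a)`. -/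
noncomputable def rellichMid (n a : ℕ) : ℝ :=
  (((n : ℝ) + 1 + 2 * a) / 2) ^ 2 * ((n : ℝ) * (n - 1 - 2 * a) / 6)
    + (n : ℝ) * (n - 1) / 6 * (((n : ℝ) - 1 - 2 * a) / 2) ^ 2

/-- The Rellich inequality with weight `t^(-2a)` in dimension `n + 1`, with three consecutive powers
on the left. The coefficient `n²/16` is not the best one, but is free of `a`. -/
theorem weighted_rellich {f : ℝ → ℝ} (hf : RadialTest f) {a n : ℕ} (hn : 2 * a + 4 ≤ n) :
    (n : ℝ) ^ 2 / 16 * energy a n f + rellichMid n a * energy (a + 1) n f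
      + rellichConst n a * energy (a + 2) n f ≤ energy a n (lap n f) := by
  have h0 := lap_weighted_hardy hf a n
  have h1 := weighted_hardy hf a (show 2 ≤ n by omega)
  have h2 := weighted_hardy hf (a + 1) (show 2 ≤ n by omega)
  have hn' : 2 * (a : ℝ) + 4 ≤ n := by exact_mod_cast hn
  have ha : (0 : ℝ) ≤ a := by positivity
  have e1 := energy_nonneg a n f
  have h1' := mul_le_mul_of_nonneg_left h1 (show 0 ≤ (n : ℝ) * (n - 1) / 6 from
    div_nonneg (mul_nonneg (by positivity) (by linarith)) (by norm_num))
  have h2' := mul_le_mul_of_nonneg_left h2 (show 0 ≤ (((n : ℝ) + 1 + 2 * a) / 2) ^ 2 by positivity)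
  have h3 : 0 ≤ ((n : ℝ) ^ 2 / 36 * ((n - 1) * (n + 1 - 2 * a) - 9 / 4)) * energy a n f :=
    mul_nonneg (mul_nonneg (by positivity) (by nlinarith)) e1
  push_cast at h2'
  rw [rellichConst, rellichMid]
  refine le_trans ?_ h0
  refine le_trans ?_ (add_le_add h1' h2')
  rw [← sub_nonneg]
  refine h3.trans_eq ?_
  ring

theorem rellichConst_pos {n a : ℕ} (hn : 2 * a + 4 ≤ n) : 0 < rellichConst n a := by
  have hn' : 2 * (a : ℝ) + 4 ≤ n := by exact_mod_cast hn
  have ha : (0 : ℝ) ≤ a := by positivity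
  have : 0 < (n : ℝ) - 3 - 2 * a := by linarith
  exact pow_pos (div_pos (mul_pos (by positivity) this) (by norm_num)) 2

theorem rellichMid_pos {n a : ℕ} (hn : 2 * a + 4 ≤ n) : 0 < rellichMid n a := by
  have hn' : 2 * (a : ℝ) + 4 ≤ n := by exact_mod_cast hn
  have ha : (0 : ℝ) ≤ a := by positivity
  have : 0 < (n : ℝ) - 1 - 2 * a := by linarith
  have hn0 : 0 < (n : ℝ) := by linarith
  exact add_pos (mul_pos (by positivity) (div_pos (mul_pos hn0 this) (by norm_num)))
    (mul_pos (div_pos (mul_pos hn0 (by linarith)) (by norm_num))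
      (pow_pos (div_pos this (by norm_num)) 2))

/-! ### Iteration -/

/-- The iterate of `weighted_rellich`. The coefficients `c` vanish off `[a, a + 2m]`, so that the
sums can be taken over one common range `i < K` for all `a` and `m`. -/
theorem weighted_rellich_iterate (K n : ℕ) (m : ℕ) : ∀ a, 2 * (a + 2 * m) ≤ n → a + 2 * m < K →
    ∃ c : ℕ → ℝ, (∀ i ∈ Icc a (a + 2 * m), 0 < c i) ∧ (∀ i ∉ Icc a (a + 2 * m), c i = 0) ∧
      c a = ((n : ℝ) ^ 2 / 16) ^ m ∧
      c (a + 2 * m) = ∏ j ∈ Finset.range m, rellichConst n (a + 2 * j) ∧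
      ∀ f, RadialTest f →
        ∑ i ∈ Finset.range K, c i * energy i n f ≤ energy a n ((lap n)^[m] f) := by
  induction m with
  | zero =>
    intro a _ hK
    refine ⟨fun i => if i = a then 1 else 0, ?_, ?_, by simp, by simp, fun f _ => ?_⟩
    · intro i hi
      have : i = a := le_antisymm (by simpa using hi.2) hi.1
      simp [this]
    · intro i hi
      have : i ≠ a := fun h => hi (by simp [h])
      simp [this]
    · simp only [ite_mul, one_mul, zero_mul]
      rw [Finset.sum_ite_eq' _ a, if_pos (Finset.mem_range.2 (by omega))]
      rfl
  | succ m ih =>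
    intro a hn hK
    obtain ⟨c0, p0, z0, l0, -, h0⟩ := ih a (by omega) (by omega)
    obtain ⟨c1, p1, z1, -, -, h1⟩ := ih (a + 1) (by omega) (by omega)
    obtain ⟨c2, p2, z2, -, t2, h2⟩ := ih (a + 2) (by omega) (by omega)
    have hA : 0 < rellichConst n a := rellichConst_pos (by omega)
    have hB : 0 < rellichMid n a := rellichMid_pos (by omega)
    have hn0 : 0 < (n : ℝ) := by exact_mod_cast (show 0 < n by omega)
    have hD : 0 < (n : ℝ) ^ 2 / 16 := by positivity
    have nn : ∀ {c : ℕ → ℝ} {S : Set ℕ}, (∀ i ∈ S, 0 < c i) → (∀ i ∉ S, c i = 0) →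
        ∀ i, 0 ≤ c i := fun {c S} hp hz i => by
      by_cases hi : i ∈ S
      · exact (hp i hi).le
      · exact (hz i hi).ge
    refine ⟨fun i => (n : ℝ) ^ 2 / 16 * c0 i + rellichMid n a * c1 i + rellichConst n a * c2 i,
      fun i hi => ?_, fun i hi => ?_, ?_, ?_, fun f hf => ?_⟩
    · have q0 := mul_nonneg hD.le (nn p0 z0 i)
      have q1 := mul_nonneg hB.le (nn p1 z1 i)
      have q2 := mul_nonneg hA.le (nn p2 z2 i)
      have hi' := hi
      rw [mem_Icc] at hi'
      rcases Nat.lt_or_ge i (a + 2 * m + 1) with h | h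
      · have := mul_pos hD (p0 i (mem_Icc.2 ⟨hi'.1, by omega⟩))
        simp only
        linarith
      · rcases Nat.lt_or_ge i (a + 2) with h' | h'
        · have := mul_pos hB (p1 i (mem_Icc.2 ⟨by omega, by omega⟩))
          simp only
          linarith
        · have := mul_pos hA (p2 i (mem_Icc.2 ⟨by omega, by omega⟩))
          simp only
          linarith
    · rw [mem_Icc] at hi
      simp only
      rw [z0 i (fun h => hi ⟨h.1, by have := h.2; omega⟩),
        z1 i (fun h => hi ⟨by have := h.1; omega, by have := h.2; omega⟩),
        z2 i (fun h => hi ⟨by have := h.1; omega, by have := h.2; omega⟩)]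
      ring
    · simp only
      rw [l0, z1 a (fun h => by have := h.1; omega), z2 a (fun h => by have := h.1; omega)]
      ring
    · simp only
      rw [z0 _ (fun h => by have := h.2; omega), z1 _ (fun h => by have := h.2; omega),
        show a + 2 * (m + 1) = a + 2 + 2 * m by ring, t2, Finset.prod_range_succ']
      simp only [mul_zero, zero_add, add_zero]
      rw [mul_comm]
      congr 1
      exact Finset.prod_congr rfl fun j _ => by congr 1; ring
    · have hg := hf.lap_iterate n m
      rw [Function.iterate_succ_apply']
      refine le_trans ?_ (weighted_rellich hg (show 2 * a + 4 ≤ n by omega))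
      have e0 := mul_le_mul_of_nonneg_left (h0 f hf) hD.le
      have e1 := mul_le_mul_of_nonneg_left (h1 f hf) hB.le
      have e2 := mul_le_mul_of_nonneg_left (h2 f hf) hA.le
      refine le_trans (le_of_eq ?_) (add_le_add (add_le_add e0 e1) e2)
      rw [Finset.mul_sum, Finset.mul_sum, Finset.mul_sum, ← Finset.sum_add_distrib,
        ← Finset.sum_add_distrib]
      exact Finset.sum_congr rfl fun i _ => by ring

theorem sq_div_sixteen_pow (x : ℝ) (m : ℕ) : (x ^ 2 / 16) ^ m = x ^ (2 * m) / 2 ^ (4 * m) := by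
  rw [div_pow, ← pow_mul, pow_mul 2 4 m]
  norm_num

/-- The inequality for the order `k = 2m`: `poincare_rellich` is applied to `Δᵐf`, and its three
terms are bounded by the induction hypothesis and by `weighted_rellich_iterate`. -/
theorem poincare_rellich_even (K n m : ℕ) (hn : 4 * m ≤ n) (hK : 2 * m < K) :
    ∃ c : ℕ → ℝ, (∀ i, 1 ≤ i → i ≤ 2 * m → 0 < c i) ∧ (∀ i, 2 * m < i → c i = 0) ∧
      c 0 = ((n : ℝ) / 2) ^ (4 * m) ∧
      c 1 = ((n : ℝ) + 1) * n / 2 ^ (4 * m) *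
        ∑ j ∈ Finset.Icc 1 m, (n : ℝ) ^ (4 * m - 2 * j - 2) ∧
      (1 ≤ m → c (2 * m) = ((n : ℝ) - 3) ^ 2 / 16 *
        ∏ j ∈ Finset.range (m - 1), rellichConst n (2 + 2 * j)) ∧
      ∀ f, RadialTest f →
        ∑ i ∈ Finset.range K, c i * energy i n f ≤ energy 0 n ((lap n)^[m] f) := by
  induction m with
  | zero =>
    refine ⟨fun i => if i = 0 then 1 else 0, fun i h1 h2 => by omega,
      fun i hi => by simp; omega, by simp, by simp, by omega, fun f _ => ?_⟩
    simp only [ite_mul, one_mul, zero_mul]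
    rw [Finset.sum_ite_eq' _ 0, if_pos (Finset.mem_range.2 (by omega))]
    rfl
  | succ m ih =>
    obtain ⟨c0, p0, z0, a0, b0, -, h0⟩ := ih (by omega) (by omega)
    obtain ⟨c1, p1, z1, a1, -, h1⟩ :=
      weighted_rellich_iterate K n m 1 (by omega) (by omega)
    obtain ⟨c2, p2, z2, -, t2, h2⟩ :=
      weighted_rellich_iterate K n m 2 (by omega) (by omega)
    have hn' : (4 : ℝ) ≤ n := by exact_mod_cast (show 4 ≤ n by omega)
    have hA : 0 < ((n : ℝ) / 2) ^ 4 := by positivity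
    have hB : 0 < ((n : ℝ) + 1) * n / 16 := by positivity
    have hD : 0 < ((n : ℝ) - 3) ^ 2 / 16 := div_pos (pow_pos (by linarith) 2) (by norm_num)
    have z10 : c1 0 = 0 := z1 0 (fun h => by have := h.1; omega)
    have z20 : c2 0 = 0 := z2 0 (fun h => by have := h.1; omega)
    refine ⟨fun i => ((n : ℝ) / 2) ^ 4 * c0 i + ((n : ℝ) + 1) * n / 16 * c1 i
      + ((n : ℝ) - 3) ^ 2 / 16 * c2 i, fun i hi1 hi2 => ?_, fun i hi => ?_, ?_, ?_, fun _ => ?_,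
      fun f hf => ?_⟩
    · have q0 : 0 ≤ c0 i := by
        rcases Nat.lt_or_ge (2 * m) i with h | h
        · exact (z0 i h).ge
        · exact (p0 i hi1 h).le
      have q1 : 0 ≤ c1 i := by
        by_cases h : i ∈ Icc 1 (1 + 2 * m)
        · exact (p1 i h).le
        · exact (z1 i h).ge
      have q2 : 0 ≤ c2 i := by
        by_cases h : i ∈ Icc 2 (2 + 2 * m)
        · exact (p2 i h).le
        · exact (z2 i h).ge
      have r0 := mul_nonneg hA.le q0
      have r1 := mul_nonneg hB.le q1
      have r2 := mul_nonneg hD.le q2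
      rcases Nat.lt_or_ge i 2 with h | h
      · have := mul_pos hB (p1 i (mem_Icc.2 ⟨hi1, by omega⟩))
        simp only
        linarith
      · have := mul_pos hD (p2 i (mem_Icc.2 ⟨h, by omega⟩))
        simp only
        linarith
    · simp only
      rw [z0 i (by omega), z1 i (fun h => by have := h.2; omega),
        z2 i (fun h => by have := h.2; omega)]
      ring
    · simp only
      rw [a0, z10, z20]
      ring
    · simp only
      rw [b0, a1, z2 1 (fun h => by have := h.1; omega), Finset.sum_Icc_succ_top (by omega)]
      have e : ∀ j ∈ Finset.Icc 1 m, (n : ℝ) ^ (4 * (m + 1) - 2 * j - 2)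
          = (n : ℝ) ^ 4 * (n : ℝ) ^ (4 * m - 2 * j - 2) := fun j hj => by
        rw [Finset.mem_Icc] at hj
        rw [← pow_add]
        congr 1
        omega
      rw [Finset.sum_congr rfl e, ← Finset.mul_sum,
        show 4 * (m + 1) - 2 * (m + 1) - 2 = 2 * m by omega, sq_div_sixteen_pow, div_pow,
        mul_add 4 m 1, pow_add]
      norm_num
      field_simp
    · simp only
      rw [z0 _ (by omega), z1 _ (fun h => by have := h.2; omega),
        show 2 * (m + 1) = 2 + 2 * m by ring, t2]
      simp
    · have hg := hf.lap_iterate n m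
      rw [Function.iterate_succ_apply']
      refine le_trans ?_ (poincare_rellich hg (show 4 ≤ n by omega))
      have e0 := mul_le_mul_of_nonneg_left (h0 f hf) hA.le
      have e1 := mul_le_mul_of_nonneg_left (h1 f hf) hB.le
      have e2 := mul_le_mul_of_nonneg_left (h2 f hf) hD.le
      refine le_trans (le_of_eq ?_) (add_le_add (add_le_add e0 e1) e2)
      rw [Finset.mul_sum, Finset.mul_sum, Finset.mul_sum, ← Finset.sum_add_distrib,
        ← Finset.sum_add_distrib]
      exact Finset.sum_congr rfl fun i _ => by ring

/-- The inequality for the order `k = 2m + 1`: `poincare_hardy` is applied to `Δᵐf`. -/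
theorem poincare_rellich_odd (K n m : ℕ) (hn : 4 * m + 2 ≤ n) (hK : 2 * m + 1 < K) :
    ∃ c : ℕ → ℝ, (∀ i, 1 ≤ i → i ≤ 2 * m + 1 → 0 < c i) ∧
      c 0 = ((n : ℝ) / 2) ^ (4 * m + 2) ∧
      c 1 = ((n : ℝ) + 1) * n / 2 ^ (4 * m + 2) *
        ∑ j ∈ Finset.Icc 1 m, (n : ℝ) ^ (2 * m + 2 * j - 2) + (n : ℝ) ^ (2 * m) / 2 ^ (4 * m + 2) ∧
      c (2 * m + 1) = 1 / 4 * ∏ j ∈ Finset.range m, rellichConst n (1 + 2 * j) ∧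
      ∀ f, RadialTest f →
        ∑ i ∈ Finset.range K, c i * energy i n f ≤ energy 0 n (deriv ((lap n)^[m] f)) := by
  obtain ⟨c0, p0, z0, a0, b0, -, h0⟩ := poincare_rellich_even K n m (by omega) (by omega)
  obtain ⟨c1, p1, z1, a1, t1, h1⟩ := weighted_rellich_iterate K n m 1 (by omega) (by omega)
  have hn' : (2 : ℝ) ≤ n := by exact_mod_cast (show 2 ≤ n by omega)
  have hA : 0 < (n : ℝ) ^ 2 / 4 := by positivity
  refine ⟨fun i => (n : ℝ) ^ 2 / 4 * c0 i + 1 / 4 * c1 i, fun i hi1 hi2 => ?_,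
    ?_, ?_, ?_, fun f hf => ?_⟩
  · have q0 : 0 ≤ c0 i := by
      rcases Nat.lt_or_ge (2 * m) i with h | h
      · exact (z0 i h).ge
      · exact (p0 i hi1 h).le
    have r0 := mul_nonneg hA.le q0
    have := p1 i (mem_Icc.2 ⟨hi1, by omega⟩)
    simp only
    linarith
  · simp only
    rw [a0, z1 0 (fun h => by have := h.1; omega)]
    ring
  · simp only
    -- The two sums over `j` run through the same powers in opposite order.
    have e : ∑ j ∈ Finset.Icc 1 m, (n : ℝ) ^ (2 * m + 2 * j - 2)
        = (n : ℝ) ^ 2 * ∑ j ∈ Finset.Icc 1 m, (n : ℝ) ^ (4 * m - 2 * j - 2) := by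
      rw [Finset.mul_sum]
      refine Finset.sum_nbij' (fun j => m + 1 - j) (fun j => m + 1 - j) ?_ ?_ ?_ ?_ ?_
      · intro j hj
        simp only [Finset.mem_Icc] at hj ⊢
        omega
      · intro j hj
        simp only [Finset.mem_Icc] at hj ⊢
        omega
      · intro j hj
        simp only [Finset.mem_Icc] at hj
        omega
      · intro j hj
        simp only [Finset.mem_Icc] at hj
        omega
      · intro j hj
        simp only [Finset.mem_Icc] at hj
        rw [← pow_add]
        congr 1
        omega
    rw [b0, a1, e, sq_div_sixteen_pow, pow_add]
    norm_num
    field_simp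
  · simp only
    rw [z0 _ (by omega), add_comm (2 * m) 1, t1]
    ring
  · have hg := hf.lap_iterate n m
    refine le_trans ?_ (poincare_hardy hg (show 2 ≤ n by omega))
    have e0 := mul_le_mul_of_nonneg_left (h0 f hf) hA.le
    have e1 := mul_le_mul_of_nonneg_left (h1 f hf) (show (0 : ℝ) ≤ 1 / 4 by norm_num)
    refine le_trans (le_of_eq ?_) (add_le_add e0 e1)
    rw [Finset.mul_sum, Finset.mul_sum, ← Finset.sum_add_distrib]
    exact Finset.sum_congr rfl fun i _ => by ring

theorem prod_rellichConst_even (n m : ℕ) :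
    ((n : ℝ) - 3) ^ 2 / 16 * ∏ j ∈ Finset.range m, rellichConst n (2 + 2 * j) =
      (((n : ℝ) + 1 - 4) / 2 ^ (2 * (m + 1))) ^ 2 * ∏ j ∈ Finset.Icc 1 m,
        ((n : ℝ) + 1 + 4 * (j : ℝ)) ^ 2 * ((n : ℝ) + 1 - 4 * (j : ℝ) - 4) ^ 2 := by
  induction m with
  | zero => norm_num; ring
  | succ m ih =>
    rw [Finset.prod_range_succ, ← mul_assoc, ih, Finset.prod_Icc_succ_top (by omega), rellichConst]
    push_cast
    field_simp
    ring

theorem prod_rellichConst_odd (n m : ℕ) :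
    1 / 4 * ∏ j ∈ Finset.range m, rellichConst n (1 + 2 * j) =
      1 / 2 ^ (4 * m + 2) * ∏ j ∈ Finset.Icc 1 m,
        ((n : ℝ) + 1 + 4 * (j : ℝ) - 2) ^ 2 * ((n : ℝ) + 1 - 4 * (j : ℝ) - 2) ^ 2 := by
  induction m with
  | zero => norm_num
  | succ m ih =>
    rw [Finset.prod_range_succ, ← mul_assoc, ih, Finset.prod_Icc_succ_top (by omega), rellichConst]
    push_cast
    field_simp
    ring

theorem sum_range_succ_eq_add_sum_Icc (k : ℕ) (g : ℕ → ℝ) :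
    ∑ i ∈ Finset.range (k + 1), g i = g 0 + ∑ i ∈ Finset.Icc 1 k, g i := by
  rw [Finset.range_eq_Ico, Finset.sum_eq_sum_Ico_succ_bot (by omega)]
  rfl

/-- The inequality on a single ray. -/
theorem radial_inequality (k n : ℕ) (hk : 1 ≤ k) (hn : 2 * k ≤ n) :
    ∃ C : ℕ → ℝ,
      (∀ i ∈ Finset.Icc 1 k, 0 < C i) ∧
      (∀ m : ℕ, k = 2 * m →
        C k = (((n : ℝ) + 1 - 4) / 2 ^ (2 * m)) ^ 2 *
            ∏ j ∈ Finset.Icc 1 (m - 1),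
              ((n : ℝ) + 1 + 4 * (j : ℝ)) ^ 2 * ((n : ℝ) + 1 - 4 * (j : ℝ) - 4) ^ 2 ∧
        C 1 = ((n : ℝ) + 1) * n / 2 ^ (4 * m) *
            ∑ j ∈ Finset.Icc 1 m, (n : ℝ) ^ (4 * m - 2 * j - 2)) ∧
      (∀ m : ℕ, k = 2 * m + 1 →
        C k = 1 / 2 ^ (4 * m + 2) *
            ∏ j ∈ Finset.Icc 1 m,
              ((n : ℝ) + 1 + 4 * (j : ℝ) - 2) ^ 2 * ((n : ℝ) + 1 - 4 * (j : ℝ) - 2) ^ 2 ∧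
        C 1 = ((n : ℝ) + 1) * n / 2 ^ (4 * m + 2) *
              ∑ j ∈ Finset.Icc 1 m, (n : ℝ) ^ (2 * m + 2 * j - 2)
            + (n : ℝ) ^ (2 * m) / 2 ^ (4 * m + 2)) ∧
      ∀ f : ℝ → ℝ, RadialTest f →
        ∑ i ∈ Finset.Icc 1 k, C i * energy i n f ≤
          energy 0 n (if Even k then (lap n)^[k / 2] f else deriv ((lap n)^[(k - 1) / 2] f)) -
            ((n : ℝ) / 2) ^ (2 * k) * energy 0 n f := by
  rcases Nat.even_or_odd' k with ⟨m, rfl | rfl⟩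
  · obtain ⟨c, hp, -, h0, h1, ht, h⟩ :=
      poincare_rellich_even (2 * m + 1) n m (by omega) (by omega)
    refine ⟨c, fun i hi => hp i (Finset.mem_Icc.1 hi).1 (Finset.mem_Icc.1 hi).2,
      fun m' hm => ?_, fun m' hm => by omega, fun f hf => ?_⟩
    · obtain rfl : m = m' := by omega
      refine ⟨?_, h1⟩
      rw [ht (by omega), prod_rellichConst_even, show m - 1 + 1 = m by omega]
    · have := h f hf
      rw [sum_range_succ_eq_add_sum_Icc, h0] at this
      rw [if_pos (even_two_mul m), Nat.mul_div_cancel_left m (by norm_num),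
        show 2 * (2 * m) = 4 * m by ring]
      linarith
  · obtain ⟨c, hp, h0, h1, ht, h⟩ :=
      poincare_rellich_odd (2 * m + 1 + 1) n m (by omega) (by omega)
    refine ⟨c, fun i hi => hp i (Finset.mem_Icc.1 hi).1 (Finset.mem_Icc.1 hi).2,
      fun m' hm => by omega, fun m' hm => ?_, fun f hf => ?_⟩
    · obtain rfl : m = m' := by omega
      exact ⟨ht.trans (prod_rellichConst_odd n m), h1⟩
    · have := h f hf
      rw [sum_range_succ_eq_add_sum_Icc, h0] at this
      rw [if_neg (by simp), Nat.add_sub_cancel, Nat.mul_div_cancel_left m (by norm_num),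
        show 2 * (2 * m + 1) = 4 * m + 2 by ring]
      linarith

/-! ### The punctured ball in geodesic polar coordinates -/

section Polar

variable {N : ℕ} {σ x : EuclideanSpace ℝ (Fin N)} {t : ℝ}

theorem tanh_half_pos (ht : 0 < t) : 0 < Real.tanh (t / 2) := by
  rw [Real.tanh_eq_sinh_div_cosh]
  exact div_pos (Real.sinh_pos_iff.2 (by linarith)) (Real.cosh_pos _)

theorem norm_polar (ht : 0 < t) (hσ : ‖σ‖ = 1) : ‖polar t σ‖ = Real.tanh (t / 2) := by
  rw [polar, norm_smul, hσ, mul_one, Real.norm_of_nonneg (tanh_half_pos ht).le]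

theorem polar_mem (ht : 0 < t) (hσ : ‖σ‖ = 1) :
    polar t σ ∈ Metric.ball (0 : EuclideanSpace ℝ (Fin N)) 1 \ {0} := by
  refine ⟨?_, ?_⟩
  · rw [mem_ball_zero_iff, norm_polar ht hσ]
    exact Real.tanh_lt_one _
  · rw [mem_singleton_iff, ← norm_eq_zero, norm_polar ht hσ]
    exact (tanh_half_pos ht).ne'

theorem inv_norm_smul_polar (ht : 0 < t) (hσ : ‖σ‖ = 1) : ‖polar t σ‖⁻¹ • polar t σ = σ := by
  rw [norm_polar ht hσ, polar, smul_smul, inv_mul_cancel₀ (tanh_half_pos ht).ne', one_smul]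

theorem exists_eq_polar (hx : x ∈ Metric.ball (0 : EuclideanSpace ℝ (Fin N)) 1 \ {0}) :
    ∃ t σ, 0 < t ∧ ‖σ‖ = 1 ∧ x = polar t σ := by
  have h1 : ‖x‖ < 1 := mem_ball_zero_iff.1 hx.1
  have h0 : 0 < ‖x‖ := norm_pos_iff.2 hx.2
  refine ⟨2 * Real.artanh ‖x‖, ‖x‖⁻¹ • x, by linarith [Real.artanh_pos ⟨h0, h1⟩], ?_, ?_⟩
  · rw [norm_smul, norm_inv, norm_norm, inv_mul_cancel₀ h0.ne']
  · rw [polar, mul_div_cancel_left₀ _ (two_ne_zero' ℝ), Real.tanh_artanh ⟨by linarith, h1⟩,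
      smul_smul, mul_inv_cancel₀ h0.ne', one_smul]

theorem hasDerivAt_tanh_half (t : ℝ) :
    HasDerivAt (fun t => Real.tanh (t / 2)) ((1 - Real.tanh (t / 2) ^ 2) / 2) t := by
  have hc : Real.cosh (t / 2) ≠ 0 := (Real.cosh_pos _).ne'
  have hd := (hasDerivAt_id t).div_const 2
  have h := hd.sinh.div hd.cosh hc
  have e : (fun t => Real.tanh (t / 2)) = fun t => Real.sinh (t / 2) / Real.cosh (t / 2) := by
    ext s
    exact Real.tanh_eq_sinh_div_cosh _
  rw [e]
  refine h.congr_deriv ?_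
  rw [Real.tanh_eq_sinh_div_cosh]
  simp only [id]
  field_simp

theorem dr_polar (v : EuclideanSpace ℝ (Fin N) → ℝ) (ht : 0 < t) (hσ : ‖σ‖ = 1) :
    dr v (polar t σ) = deriv (fun s => v (polar s σ)) t := by
  rw [dr, inv_norm_smul_polar ht hσ, rad_polar ht.le hσ]

theorem radLap_polar (v : EuclideanSpace ℝ (Fin N) → ℝ) (ht : 0 < t) (hσ : ‖σ‖ = 1) :
    radLap v (polar t σ) = lap ((N : ℝ) - 1) (fun s => v (polar s σ)) t := by
  have h : (fun s => dr v (polar s σ)) =ᶠ[𝓝 t] deriv fun s => v (polar s σ) := by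
    filter_upwards [Ioi_mem_nhds ht] with s hs using dr_polar v hs hσ
  rw [radLap, lap, dr_polar _ ht hσ, dr_polar _ ht hσ, h.deriv_eq, rad_polar ht.le hσ]

theorem lap_congr {f g : ℝ → ℝ} (n : ℝ) (h : ∀ t, 0 < t → f t = g t) (ht : 0 < t) :
    lap n f t = lap n g t := by
  have h1 : f =ᶠ[𝓝 t] g := by
    filter_upwards [Ioi_mem_nhds ht] with s hs using h s hs
  rw [lap, lap, h1.deriv.deriv_eq, h1.deriv_eq]

theorem radLap_iterate_polar (v : EuclideanSpace ℝ (Fin N) → ℝ) (hσ : ‖σ‖ = 1) (m : ℕ) :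
    ∀ t, 0 < t →
      (radLap^[m] v) (polar t σ) = ((lap ((N : ℝ) - 1))^[m] fun s => v (polar s σ)) t := by
  induction m with
  | zero => exact fun _ _ => rfl
  | succ m ih =>
    intro t ht
    rw [Function.iterate_succ_apply', Function.iterate_succ_apply', radLap_polar _ ht hσ]
    exact lap_congr _ ih ht

theorem tangentNorm_radGrad (v : EuclideanSpace ℝ (Fin N) → ℝ)
    (hx : x ∈ Metric.ball (0 : EuclideanSpace ℝ (Fin N)) 1 \ {0}) :
    tangentNorm x (radGrad v x) = |dr v x| := by
  have h1 : ‖x‖ < 1 := mem_ball_zero_iff.1 hx.1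
  have h0 : 0 < ‖x‖ := norm_pos_iff.2 hx.2
  have hc : 0 < conf x := div_pos two_pos (by nlinarith)
  rw [tangentNorm, radGrad, norm_smul, norm_smul, norm_smul, norm_inv, norm_inv, norm_norm,
    inv_mul_cancel₀ h0.ne', Real.norm_of_nonneg hc.le, Real.norm_eq_abs]
  field_simp

theorem absRadNabla_sq (k : ℕ) (v : EuclideanSpace ℝ (Fin N) → ℝ)
    (hx : x ∈ Metric.ball (0 : EuclideanSpace ℝ (Fin N)) 1 \ {0}) :
    absRadNabla k v x ^ 2 =
      (if Even k then radLap^[k / 2] v else dr (radLap^[(k - 1) / 2] v)) x ^ 2 := by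
  rw [absRadNabla]
  split_ifs with h
  · rw [sq_abs]
  · rw [tangentNorm_radGrad _ hx, sq_abs]

/-- On a ray from the pole, `|∇_r^k u|²` is given by the one-dimensional operators. -/
theorem absRadNabla_sq_polar (k : ℕ) (v : EuclideanSpace ℝ (Fin N) → ℝ) (ht : 0 < t)
    (hσ : ‖σ‖ = 1) :
    absRadNabla k v (polar t σ) ^ 2 =
      (if Even k then (lap ((N : ℝ) - 1))^[k / 2] fun s => v (polar s σ)
        else deriv ((lap ((N : ℝ) - 1))^[(k - 1) / 2] fun s => v (polar s σ))) t ^ 2 := by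
  rw [absRadNabla_sq k v (polar_mem ht hσ)]
  split_ifs
  · rw [radLap_iterate_polar v hσ _ t ht]
  · have h : (fun s => (radLap^[(k - 1) / 2] v) (polar s σ)) =ᶠ[𝓝 t]
        (lap ((N : ℝ) - 1))^[(k - 1) / 2] fun s => v (polar s σ) := by
      filter_upwards [Ioi_mem_nhds ht] with s hs using radLap_iterate_polar v hσ _ s hs
    rw [dr_polar _ ht hσ, h.deriv_eq]

theorem cosh_rad_div_sinh_rad (hx : x ∈ Metric.ball (0 : EuclideanSpace ℝ (Fin N)) 1 \ {0}) :
    Real.cosh (rad x) / Real.sinh (rad x) = (1 + ‖x‖ ^ 2) / (2 * ‖x‖) := by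
  obtain ⟨t, σ, ht, hσ, rfl⟩ := exists_eq_polar hx
  have hc : 0 < Real.cosh (t / 2) := Real.cosh_pos _
  have hs : 0 < Real.sinh (t / 2) := Real.sinh_pos_iff.2 (by linarith)
  rw [rad_polar ht.le hσ, norm_polar ht hσ, Real.tanh_eq_sinh_div_cosh]
  nth_rewrite 1 2 [show t = 2 * (t / 2) by ring]
  rw [Real.cosh_two_mul, Real.sinh_two_mul]
  field_simp

theorem rad_pos (hx : x ∈ Metric.ball (0 : EuclideanSpace ℝ (Fin N)) 1 \ {0}) : 0 < rad x := by
  obtain ⟨t, σ, ht, hσ, rfl⟩ := exists_eq_polar hx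
  rwa [rad_polar ht.le hσ]

theorem continuousOn_rad :
    ContinuousOn (rad (N := N)) (Metric.ball (0 : EuclideanSpace ℝ (Fin N)) 1 \ {0}) := by
  have hb : ∀ x ∈ Metric.ball (0 : EuclideanSpace ℝ (Fin N)) 1 \ {0},
      0 < (1 - ‖x‖ ^ 2) * (1 - ‖(0 : EuclideanSpace ℝ (Fin N))‖ ^ 2) := fun x hx => by
    have h1 : ‖x‖ < 1 := mem_ball_zero_iff.1 hx.1
    have h0 := norm_nonneg x
    rw [norm_zero]
    nlinarith
  refine Real.continuousOn_arcosh.comp (t := Ici 1) ?_ fun x hx => ?_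
  · exact continuousOn_const.add (ContinuousOn.div (by fun_prop) (by fun_prop)
      fun x hx => (hb x hx).ne')
  · have := hb x hx
    simp only [mem_Ici, le_add_iff_nonneg_right]
    positivity

theorem isOpen_punctured :
    IsOpen (Metric.ball (0 : EuclideanSpace ℝ (Fin N)) 1 \ {0}) :=
  Metric.isOpen_ball.sdiff isClosed_singleton

end Polar

/-! ### Test functions on the punctured ball -/

/-- A function that is smooth on the punctured ball and vanishes there off a shell
`a ≤ ‖x‖ ≤ b` with `0 < a` and `b < 1`. In contrast to `IsTest`, nothing is asked at the centre
or outside the ball, so that the class is stable under `dr` and `radLap`. -/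
structure ShellTest {N : ℕ} (v : EuclideanSpace ℝ (Fin N) → ℝ) : Prop where
  smooth : ContDiffOn ℝ ∞ v (Metric.ball 0 1 \ {0})
  support : ∃ a b : ℝ, 0 < a ∧ b < 1 ∧
    ∀ x ∈ Metric.ball (0 : EuclideanSpace ℝ (Fin N)) 1 \ {0}, ‖x‖ ∉ Icc a b → v x = 0

theorem IsTest.shellTest {N : ℕ} {u : EuclideanSpace ℝ (Fin N) → ℝ} (hu : IsTest u) :
    ShellTest u where
  smooth := hu.smooth.contDiffOn
  support := by
    have hz : ∀ x ∉ tsupport u, u x = 0 := fun x hx => image_eq_zero_of_notMem_tsupport hx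
    rcases (tsupport u).eq_empty_or_nonempty with he | hne
    · exact ⟨1 / 2, 1 / 2, by norm_num, by norm_num, fun x _ _ => hz x (by simp [he])⟩
    · obtain ⟨p, hp, hpm⟩ := hu.compact.isCompact.exists_isMinOn hne continuous_norm.continuousOn
      obtain ⟨q, hq, hqm⟩ := hu.compact.isCompact.exists_isMaxOn hne continuous_norm.continuousOn
      exact ⟨‖p‖, ‖q‖, norm_pos_iff.2 (hu.support hp).2, mem_ball_zero_iff.1 (hu.support hq).1,
        fun x _ hx => hz x fun h => hx ⟨hpm h, hqm h⟩⟩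

namespace ShellTest

variable {N : ℕ} {v : EuclideanSpace ℝ (Fin N) → ℝ}

theorem hasFDerivAt (hv : ShellTest v) {x : EuclideanSpace ℝ (Fin N)}
    (hx : x ∈ Metric.ball (0 : EuclideanSpace ℝ (Fin N)) 1 \ {0}) :
    HasFDerivAt v (fderiv ℝ v x) x :=
  ((hv.smooth.contDiffAt (isOpen_punctured.mem_nhds hx)).differentiableAt (by simp)).hasFDerivAt

theorem radialTest (hv : ShellTest v) {σ : EuclideanSpace ℝ (Fin N)} (hσ : ‖σ‖ = 1) :
    RadialTest fun t => v (polar t σ) where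
  smooth := by
    have hp : ContDiff ℝ ∞ fun t => polar t σ := by
      have : (fun t => polar t σ) = fun t => (Real.sinh (t / 2) / Real.cosh (t / 2)) • σ := by
        ext1 t
        rw [polar, Real.tanh_eq_sinh_div_cosh]
      rw [this]
      have hh : ContDiff ℝ ∞ fun t : ℝ => t / 2 := contDiff_id.div_const 2
      exact ((Real.contDiff_sinh.comp hh).div (Real.contDiff_cosh.comp hh)
        fun t => (Real.cosh_pos _).ne').smul contDiff_const
    exact hv.smooth.comp hp.contDiffOn fun t ht => polar_mem ht hσ
  support := by
    obtain ⟨a, b, ha, hb, hab⟩ := hv.support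
    -- The support lies in `2 artanh a ≤ t ≤ 2 artanh b`; `a` and `b` are moved into `[0, 1)`,
    -- where `artanh` is not a junk value, since only `0 < a` and `b < 1` are known.
    refine ⟨2 * Real.artanh (min a (1 / 2)), 2 * Real.artanh (max b 0), ?_, fun t ht htab => ?_⟩
    · have : 0 < min a (1 / 2) := lt_min ha (by norm_num)
      have h2 : min a (1 / 2) ≤ 1 / 2 := min_le_right _ _
      linarith [Real.artanh_pos ⟨this, by linarith⟩]
    · refine hab _ (polar_mem ht hσ) fun h => htab ?_
      rw [norm_polar ht hσ] at h
      have h0 := tanh_half_pos ht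
      have h1 := Real.tanh_lt_one (t / 2)
      have e1 : Real.artanh (min a (1 / 2)) ≤ Real.artanh (Real.tanh (t / 2)) :=
        Real.artanh_le_artanh (by linarith [lt_min ha (show (0 : ℝ) < 1 / 2 by norm_num)]) h1
          ((min_le_left _ _).trans h.1)
      have e2 : Real.artanh (Real.tanh (t / 2)) ≤ Real.artanh (max b 0) :=
        Real.artanh_le_artanh (by linarith) (max_lt hb one_pos) (h.2.trans (le_max_left _ _))
      rw [Real.artanh_tanh] at e1 e2
      exact ⟨by linarith, by linarith⟩

theorem dr_eq (hv : ShellTest v) {x : EuclideanSpace ℝ (Fin N)}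
    (hx : x ∈ Metric.ball (0 : EuclideanSpace ℝ (Fin N)) 1 \ {0}) :
    dr v x = (1 - ‖x‖ ^ 2) / (2 * ‖x‖) * fderiv ℝ v x x := by
  obtain ⟨t, σ, ht, hσ, rfl⟩ := exists_eq_polar hx
  have h := (hv.hasFDerivAt hx).comp_hasDerivAt t ((hasDerivAt_tanh_half t).smul_const σ)
  have e : fderiv ℝ v (polar t σ) (polar t σ) = Real.tanh (t / 2) * fderiv ℝ v (polar t σ) σ := by
    conv_lhs => rw [polar]
    rw [map_smul, smul_eq_mul]
    rfl
  have h0 := tanh_half_pos ht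
  rw [dr_polar v ht hσ, norm_polar ht hσ, e]
  refine h.deriv.trans ?_
  rw [map_smul, smul_eq_mul]
  field_simp

theorem dr (hv : ShellTest v) : ShellTest (dr v) where
  smooth := by
    have hn : ContDiffOn ℝ ∞ (fun x : EuclideanSpace ℝ (Fin N) => ‖x‖) (Metric.ball 0 1 \ {0}) :=
      contDiffOn_id.norm ℝ fun x hx => hx.2
    have h1 : ContDiffOn ℝ ∞ (fun x => fderiv ℝ v x x) (Metric.ball 0 1 \ {0}) :=
      (hv.smooth.fderiv_of_isOpen isOpen_punctured (by simp)).clm_apply contDiffOn_id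
    refine ContDiffOn.congr (ContDiffOn.mul (ContDiffOn.div (contDiffOn_const.sub (hn.pow 2))
      (contDiffOn_const.mul hn) fun x hx => ?_) h1) fun x hx => hv.dr_eq hx
    exact mul_ne_zero two_ne_zero (norm_ne_zero_iff.2 hx.2)
  support := by
    obtain ⟨a, b, ha, hb, hab⟩ := hv.support
    refine ⟨a, b, ha, hb, fun x hx hxab => ?_⟩
    have h : v =ᶠ[𝓝 x] fun _ => 0 := by
      filter_upwards [isOpen_punctured.mem_nhds hx,
        (isClosed_Icc.preimage continuous_norm).isOpen_compl.mem_nhds hxab] with y hy hy'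
        using hab y hy hy'
    rw [hv.dr_eq hx, h.fderiv_eq]
    simp

theorem radLap (hv : ShellTest v) : ShellTest (radLap v) where
  smooth := by
    have hn : ContDiffOn ℝ ∞ (fun x : EuclideanSpace ℝ (Fin N) => ‖x‖) (Metric.ball 0 1 \ {0}) :=
      contDiffOn_id.norm ℝ fun x hx => hx.2
    have hc : ContDiffOn ℝ ∞ (fun x : EuclideanSpace ℝ (Fin N) =>
        Real.cosh (rad x) / Real.sinh (rad x)) (Metric.ball 0 1 \ {0}) :=
      ContDiffOn.congr (ContDiffOn.div (contDiffOn_const.add (hn.pow 2))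
        (contDiffOn_const.mul hn) fun x hx =>
          mul_ne_zero two_ne_zero (norm_ne_zero_iff.2 hx.2)) fun x hx => cosh_rad_div_sinh_rad hx
    exact hv.dr.dr.smooth.add ((contDiffOn_const.mul hc).mul hv.dr.smooth)
  support := by
    obtain ⟨a, b, ha, hb, hab⟩ := hv.dr.support
    obtain ⟨a', b', ha', hb', hab'⟩ := hv.dr.dr.support
    refine ⟨min a a', max b b', lt_min ha ha', max_lt hb hb', fun x hx hxab => ?_⟩
    have h1 : ‖x‖ ∉ Icc a b := fun h => hxab ⟨(min_le_left _ _).trans h.1,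
      h.2.trans (le_max_left _ _)⟩
    have h2 : ‖x‖ ∉ Icc a' b' := fun h => hxab ⟨(min_le_right _ _).trans h.1,
      h.2.trans (le_max_right _ _)⟩
    simp [HypBall.radLap, hab x hx h1, hab' x hx h2]

theorem radLap_iterate (hv : ShellTest v) (m : ℕ) : ShellTest (HypBall.radLap^[m] v) := by
  induction m with
  | zero => exact hv
  | succ m ih =>
    rw [Function.iterate_succ_apply']
    exact ih.radLap

end ShellTest

/-! ### The volume in geodesic polar coordinates -/

section Volume

variable {N : ℕ}

theorem conf_pow_nonneg {x : EuclideanSpace ℝ (Fin N)}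
    (hx : x ∈ Metric.ball (0 : EuclideanSpace ℝ (Fin N)) 1) : 0 ≤ conf x ^ N := by
  have h1 : ‖x‖ < 1 := mem_ball_zero_iff.1 hx
  have h0 := norm_nonneg x
  exact pow_nonneg (div_nonneg zero_le_two (by nlinarith)) N

theorem measurable_ofReal_conf_pow :
    Measurable fun x : EuclideanSpace ℝ (Fin N) => ENNReal.ofReal (conf x ^ N) := by
  unfold conf
  fun_prop

theorem integrable_vol_iff {G : EuclideanSpace ℝ (Fin N) → ℝ} :
    Integrable G (vol N) ↔ IntegrableOn (fun x => conf x ^ N * G x) (Metric.ball 0 1) := by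
  rw [vol, integrable_withDensity_iff_integrable_smul' measurable_ofReal_conf_pow
    (ae_of_all _ fun _ => ENNReal.ofReal_lt_top)]
  refine integrable_congr ?_
  filter_upwards [ae_restrict_mem Metric.isOpen_ball.measurableSet] with x hx
  rw [ENNReal.toReal_ofReal (conf_pow_nonneg hx), smul_eq_mul]

theorem integral_vol {G : EuclideanSpace ℝ (Fin N) → ℝ} :
    ∫ x, G x ∂(vol N) = ∫ x in Metric.ball 0 1, conf x ^ N * G x := by
  rw [vol, integral_withDensity_eq_integral_toReal_smul measurable_ofReal_conf_pow
    (ae_of_all _ fun _ => ENNReal.ofReal_lt_top)]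
  refine setIntegral_congr_fun Metric.isOpen_ball.measurableSet fun x hx => ?_
  rw [ENNReal.toReal_ofReal (conf_pow_nonneg hx), smul_eq_mul]

/-- Only continuity of `h` on the punctured ball is needed: the shell is compact there. -/
theorem ShellTest.integrable_mul (hN : 1 ≤ N) {v h : EuclideanSpace ℝ (Fin N) → ℝ}
    (hv : ShellTest v) (hh : ContinuousOn h (Metric.ball 0 1 \ {0})) :
    Integrable (fun x => v x * h x) (vol N) := by
  have : Nonempty (Fin N) := ⟨⟨0, hN⟩⟩
  obtain ⟨a, b, ha, hb, hab⟩ := hv.support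
  have hK : IsCompact {x : EuclideanSpace ℝ (Fin N) | ‖x‖ ∈ Icc a b} := by
    refine (isCompact_closedBall (0 : EuclideanSpace ℝ (Fin N)) b).of_isClosed_subset
      (isClosed_Icc.preimage continuous_norm) fun x hx => mem_closedBall_zero_iff.2 hx.2
  have hsub : {x : EuclideanSpace ℝ (Fin N) | ‖x‖ ∈ Icc a b} ⊆ Metric.ball 0 1 \ {0} :=
    fun x hx => ⟨mem_ball_zero_iff.2 (hx.2.trans_lt hb), norm_pos_iff.1 (ha.trans_le hx.1)⟩
  have hc : ContinuousOn (fun x : EuclideanSpace ℝ (Fin N) => conf x ^ N)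
      (Metric.ball 0 1 \ {0}) := by
    refine ContinuousOn.pow (ContinuousOn.div continuousOn_const (by fun_prop) fun x hx => ?_) N
    have h1 : ‖x‖ < 1 := mem_ball_zero_iff.1 hx.1
    have h0 := norm_nonneg x
    nlinarith
  rw [integrable_vol_iff]
  have hi : IntegrableOn (fun x => conf x ^ N * (v x * h x)) (Metric.ball 0 1 \ {0}) :=
    (((hc.mul (hv.smooth.continuousOn.mul hh)).mono hsub).integrableOn_compact
      hK).of_forall_sdiff_eq_zero isOpen_punctured.measurableSet
        fun x hx => by simp [hab x hx.1 hx.2]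
  exact hi.congr_set_ae (sdiff_null_ae_eq_self (measure_singleton _)).symm

/-- Integration in polar coordinates over the unit ball of a finite-dimensional space. -/
theorem integral_ball_eq_integral_sphere {E : Type*} [NormedAddCommGroup E] [NormedSpace ℝ E]
    [Nontrivial E] [FiniteDimensional ℝ E] [MeasurableSpace E] [BorelSpace E] (μ : Measure E)
    [μ.IsAddHaarMeasure] {F : E → ℝ} (hF : IntegrableOn F (Metric.ball 0 1) μ) :
    ∫ x in Metric.ball 0 1, F x ∂μ = ∫ σ : Metric.sphere (0 : E) 1,
      (∫ r in Ioo (0 : ℝ) 1, r ^ (Module.finrank ℝ E - 1) * F (r • (σ : E))) ∂μ.toSphere := by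
  set F' : E → ℝ := (Metric.ball 0 1).indicator F with hF'
  have hb : MeasurableSet (Metric.ball (0 : E) 1) := Metric.isOpen_ball.measurableSet
  have hFi : Integrable F' μ := (integrable_indicator_iff hb).2 hF
  have mp := μ.measurePreserving_homeomorphUnitSphereProd
  have me := (homeomorphUnitSphereProd E).measurableEmbedding
  set Φ : Metric.sphere (0 : E) 1 × Ioi (0 : ℝ) → ℝ :=
    fun p => F' ((p.2 : ℝ) • (p.1 : E)) with hΦ
  have hcomp : ∀ x : ({0}ᶜ : Set E), Φ (homeomorphUnitSphereProd E x) = F' x := fun x => by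
    have := congrArg Subtype.val ((homeomorphUnitSphereProd E).symm_apply_apply x)
    rw [homeomorphUnitSphereProd_symm_apply_coe] at this
    simp only [hΦ, this]
  have hΦi : Integrable Φ (μ.toSphere.prod
      (Measure.volumeIoiPow (Module.finrank ℝ E - 1))) := by
    rw [← mp.integrable_comp_emb me]
    refine Integrable.congr ?_ (ae_of_all _ fun x => (hcomp x).symm)
    have := (integrableOn_iff_comap_subtypeVal (s := ({0}ᶜ : Set E)) (f := F') (μ := μ)
      (measurableSet_singleton 0).compl).1 hFi.integrableOn
    exact this
  calc ∫ x in Metric.ball 0 1, F x ∂μ = ∫ x, F' x ∂μ := (integral_indicator hb).symm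
    _ = ∫ x : ({0}ᶜ : Set E), F' x ∂(μ.comap (↑)) := by
      rw [integral_subtype_comap (measurableSet_singleton _).compl F', restrict_compl_singleton]
    _ = ∫ p, Φ p ∂(μ.toSphere.prod
          (Measure.volumeIoiPow (Module.finrank ℝ E - 1))) := by
      rw [← mp.integral_comp me]
      exact integral_congr_ae (ae_of_all _ fun x => (hcomp x).symm)
    _ = ∫ σ, ∫ r, Φ (σ, r) ∂(Measure.volumeIoiPow (Module.finrank ℝ E - 1))
          ∂μ.toSphere := integral_prod _ hΦi
    _ = _ := by
      refine integral_congr_ae (ae_of_all _ fun σ => ?_)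
      have hσ : ‖(σ : E)‖ = 1 := mem_sphere_zero_iff_norm.1 σ.2
      simp only [Measure.volumeIoiPow]
      rw [integral_withDensity_eq_integral_toReal_smul (by fun_prop)
        (ae_of_all _ fun _ => ENNReal.ofReal_lt_top),
        integral_subtype_comap measurableSet_Ioi
          fun r : ℝ => (ENNReal.ofReal (r ^ (Module.finrank ℝ E - 1))).toReal • F' (r • (σ : E)),
        ← integral_indicator measurableSet_Ioi, ← integral_indicator measurableSet_Ioo]
      congr 1
      ext r
      by_cases h0 : 0 < r
      · rw [indicator_of_mem (mem_Ioi.2 h0), ENNReal.toReal_ofReal (pow_nonneg h0.le _),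
          smul_eq_mul]
        have hn : ‖r • (σ : E)‖ = r := by rw [norm_smul, hσ, mul_one, Real.norm_of_nonneg h0.le]
        by_cases h1 : r < 1
        · rw [indicator_of_mem (mem_Ioo.2 ⟨h0, h1⟩), hF',
            indicator_of_mem (mem_ball_zero_iff.2 (by rwa [hn]))]
        · rw [indicator_of_notMem (fun h => h1 h.2), hF',
            indicator_of_notMem (fun h => h1 (by rwa [mem_ball_zero_iff, hn] at h)), mul_zero]
      · rw [indicator_of_notMem (show r ∉ Ioi 0 from h0),
          indicator_of_notMem (show r ∉ Ioo 0 1 from fun h => h0 h.1)]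

theorem image_tanh_half : (fun t => Real.tanh (t / 2)) '' Ioi 0 = Ioo 0 1 := by
  ext r
  constructor
  · rintro ⟨t, ht, rfl⟩
    exact ⟨tanh_half_pos ht, Real.tanh_lt_one _⟩
  · intro hr
    refine ⟨2 * Real.artanh r, ?_, ?_⟩
    · have := Real.artanh_pos hr
      simpa using this
    · simp only
      rw [mul_div_cancel_left₀ _ (two_ne_zero' ℝ), Real.tanh_artanh ⟨by linarith [hr.1], hr.2⟩]

/-- Integration over hyperbolic space in geodesic polar coordinates: `dv = sinhᴺ⁻¹ t dt dσ`. -/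
theorem integral_vol_eq_integral_polar (hN : 1 ≤ N) {G : EuclideanSpace ℝ (Fin N) → ℝ}
    (hG : Integrable G (vol N)) :
    ∫ x, G x ∂(vol N) =
      ∫ σ : Metric.sphere (0 : EuclideanSpace ℝ (Fin N)) 1,
        (∫ t in Ioi 0, G (polar t (σ : EuclideanSpace ℝ (Fin N))) * Real.sinh t ^ (N - 1))
        ∂(volume : Measure (EuclideanSpace ℝ (Fin N))).toSphere := by
  have : Nonempty (Fin N) := ⟨⟨0, hN⟩⟩
  rw [integral_vol, integral_ball_eq_integral_sphere volume (integrable_vol_iff.1 hG),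
    finrank_euclideanSpace_fin]
  refine integral_congr_ae (ae_of_all _ fun σ => ?_)
  have hσ : ‖(σ : EuclideanSpace ℝ (Fin N))‖ = 1 := mem_sphere_zero_iff_norm.1 σ.2
  have hinj : InjOn (fun t => Real.tanh (t / 2)) (Ioi 0) := fun s _ t _ hst => by
    have := Real.tanh_injective hst
    linarith
  simp only
  rw [← image_tanh_half, integral_image_eq_integral_abs_deriv_smul measurableSet_Ioi
    (fun t _ => (hasDerivAt_tanh_half t).hasDerivWithinAt) hinj]
  refine setIntegral_congr_fun measurableSet_Ioi fun t ht => ?_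
  have hc : 0 < Real.cosh (t / 2) := Real.cosh_pos _
  have hcs := Real.cosh_sq (t / 2)
  have h1 : 1 - Real.tanh (t / 2) ^ 2 = 1 / Real.cosh (t / 2) ^ 2 := by
    rw [Real.tanh_eq_sinh_div_cosh]
    field_simp
    linarith
  have hconf : conf (polar t (σ : EuclideanSpace ℝ (Fin N))) = 2 * Real.cosh (t / 2) ^ 2 := by
    rw [conf, norm_polar ht hσ, h1]
    field_simp
  have hs : Real.sinh t = 2 * Real.sinh (t / 2) * Real.cosh (t / 2) := by
    rw [← Real.sinh_two_mul]
    congr 1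
    ring
  obtain ⟨n, rfl⟩ : ∃ n, N = n + 1 := ⟨N - 1, by omega⟩
  simp only [smul_eq_mul, Nat.add_sub_cancel]
  change _ * (_ * (conf (polar t (σ : EuclideanSpace ℝ (Fin (n + 1)))) ^ (n + 1) *
    G (polar t (σ : EuclideanSpace ℝ (Fin (n + 1)))))) = _
  rw [abs_of_pos (by rw [h1]; positivity), h1, hconf, hs, Real.tanh_eq_sinh_div_cosh]
  generalize Real.cosh (t / 2) = c at hc
  have e : (Real.sinh (t / 2) / c) ^ n * (2 * c ^ 2) ^ n = (2 * Real.sinh (t / 2) * c) ^ n := by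
    rw [← mul_pow]
    congr 1
    field_simp
  rw [← e]
  field_simp
  ring

end Volume

/-! ### The inequality on hyperbolic space -/

section Main

variable {N : ℕ} {u : EuclideanSpace ℝ (Fin N) → ℝ}

theorem ShellTest.integrable_absRadNabla_sq (hN : 1 ≤ N) (hu : ShellTest u) (k : ℕ) :
    Integrable (fun x => absRadNabla k u x ^ 2) (vol N) := by
  have hv : ShellTest (if Even k then HypBall.radLap^[k / 2] u
      else HypBall.dr (HypBall.radLap^[(k - 1) / 2] u)) := by
    split_ifs
    · exact hu.radLap_iterate _
    · exact (hu.radLap_iterate _).dr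
  refine (hv.integrable_mul hN hv.smooth.continuousOn).congr ?_
  have : Nonempty (Fin N) := ⟨⟨0, hN⟩⟩
  have hae : ∀ᵐ x ∂(vol N), x ∈ Metric.ball (0 : EuclideanSpace ℝ (Fin N)) 1 \ {0} := by
    refine (withDensity_absolutelyContinuous _ _).ae_le ?_
    filter_upwards [ae_restrict_mem Metric.isOpen_ball.measurableSet,
      ae_restrict_of_ae (Measure.ae_ne volume 0)] with x h1 h2 using ⟨h1, h2⟩
  filter_upwards [hae] with x hx
  rw [absRadNabla_sq k u hx, pow_two]

theorem ShellTest.integrable_sq_div_rad_pow (hN : 1 ≤ N) (hu : ShellTest u) (i : ℕ) :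
    Integrable (fun x => u x ^ 2 / rad x ^ (2 * i)) (vol N) := by
  have h := hu.integrable_mul hN (h := fun x => u x / rad x ^ (2 * i))
    (hu.smooth.continuousOn.div (continuousOn_rad.pow _) fun x hx => pow_ne_zero _ (rad_pos hx).ne')
  refine h.congr (ae_of_all _ fun x => ?_)
  simp only
  ring

theorem integral_sub_sub_sum {α : Type*} [MeasurableSpace α] {μ : Measure α} {p q : α → ℝ}
    {r : ℕ → α → ℝ} (s : Finset ℕ) (C : ℕ → ℝ) (c : ℝ) (hp : Integrable p μ) (hq : Integrable q μ)
    (hr : ∀ i, Integrable (r i) μ) :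
    Integrable (fun x => p x - c * q x - ∑ i ∈ s, C i * r i x) μ ∧
      ∫ x, p x - c * q x - ∑ i ∈ s, C i * r i x ∂μ =
        (∫ x, p x ∂μ) - c * (∫ x, q x ∂μ) - ∑ i ∈ s, C i * ∫ x, r i x ∂μ := by
  have hd : Integrable (fun x => p x - c * q x) μ := hp.sub (hq.const_mul c)
  have hs : Integrable (fun x => ∑ i ∈ s, C i * r i x) μ :=
    integrable_finsetSum _ fun i _ => (hr i).const_mul _
  refine ⟨hd.sub hs, ?_⟩
  rw [integral_sub hd hs, integral_sub hp (hq.const_mul c), integral_const_mul,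
    integral_finsetSum _ fun i _ => (hr i).const_mul _]
  simp only [integral_const_mul]

/-- An inequality between the energies of all restrictions of `u` to rays from the pole
integrates to an inequality on hyperbolic space. -/
theorem ShellTest.sum_le_of_radial {n : ℕ} {u : EuclideanSpace ℝ (Fin (n + 1)) → ℝ}
    (hu : ShellTest u) (k : ℕ) (C : ℕ → ℝ) (c : ℝ)
    (h : ∀ f : ℝ → ℝ, RadialTest f → ∑ i ∈ Finset.Icc 1 k, C i * energy i n f ≤
      energy 0 n (if Even k then (lap n)^[k / 2] f else deriv ((lap n)^[(k - 1) / 2] f)) -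
        c * energy 0 n f) :
    ∑ i ∈ Finset.Icc 1 k, C i * ∫ x, u x ^ 2 / rad x ^ (2 * i) ∂(vol (n + 1)) ≤
      (∫ x, absRadNabla k u x ^ 2 ∂(vol (n + 1))) - c * ∫ x, u x ^ 2 ∂(vol (n + 1)) := by
  have hN : 1 ≤ n + 1 := by omega
  have iA := hu.integrable_absRadNabla_sq hN k
  have iU : Integrable (fun x => u x ^ 2) (vol (n + 1)) := by
    simpa using hu.integrable_sq_div_rad_pow hN 0
  obtain ⟨iG, e⟩ := integral_sub_sub_sum (Finset.Icc 1 k) C c iA iU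
    fun i => hu.integrable_sq_div_rad_pow hN i
  rw [← sub_nonneg, ← e]
  refine (integral_nonneg fun σ => ?_).trans_eq (integral_vol_eq_integral_polar hN iG).symm
  have hσ : ‖(σ : EuclideanSpace ℝ (Fin (n + 1)))‖ = 1 := mem_sphere_zero_iff_norm.1 σ.2
  set f : ℝ → ℝ := fun t => u (polar t (σ : EuclideanSpace ℝ (Fin (n + 1)))) with hfdef
  have hf : RadialTest f := hu.radialTest hσ
  set g : ℝ → ℝ := if Even k then (lap n)^[k / 2] f else deriv ((lap n)^[(k - 1) / 2] f) with hgdef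
  have hg : RadialTest g := by
    rw [hgdef]
    split_ifs
    · exact hf.lap_iterate _ _
    · exact (hf.lap_iterate _ _).deriv
  have jg := hg.integrableOn_sq_mul_wt 0 n
  have jf := fun i => hf.integrableOn_sq_mul_wt i n
  have key := (integral_sub_sub_sum (Finset.Icc 1 k) C c jg (jf 0) jf).2
  refine (sub_nonneg.2 (h f hf)).trans_eq (key.symm.trans ?_)
  refine setIntegral_congr_fun measurableSet_Ioi fun t ht => ?_
  have hgt : absRadNabla k u (polar t (σ : EuclideanSpace ℝ (Fin (n + 1)))) ^ 2 = g t ^ 2 := by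
    rw [absRadNabla_sq_polar k u ht hσ, hgdef]
    simp [hfdef]
  simp only [hgt, rad_polar (le_of_lt ht) hσ, wt, zpow_natCast, Nat.add_sub_cancel]
  rw [sub_mul, sub_mul, Finset.sum_mul]
  congr 1
  · simp only [mul_zero, pow_zero, inv_one, one_mul, hfdef]
    ring
  · exact Finset.sum_congr rfl fun i _ => by ring

end Main

end HypBall


theorem mainTheorem2 (k N : ℕ) (hk : 1 ≤ k) (hN : 2 * k < N) :
    ∃ C : ℕ → ℝ,
      (∀ i ∈ Finset.Icc 1 k, 0 < C i) ∧
      (∀ m : ℕ, k = 2 * m →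
        C k = (((N : ℝ) - 4) / 2 ^ (2 * m)) ^ 2 *
            ∏ j ∈ Finset.Icc 1 (m - 1),
              ((N : ℝ) + 4 * (j : ℝ)) ^ 2 * ((N : ℝ) - 4 * (j : ℝ) - 4) ^ 2 ∧
        C 1 = (N : ℝ) * ((N : ℝ) - 1) / 2 ^ (4 * m) *
            ∑ j ∈ Finset.Icc 1 m, ((N : ℝ) - 1) ^ (4 * m - 2 * j - 2)) ∧
      (∀ m : ℕ, k = 2 * m + 1 →
        C k = 1 / 2 ^ (4 * m + 2) *
            ∏ j ∈ Finset.Icc 1 m,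
              ((N : ℝ) + 4 * (j : ℝ) - 2) ^ 2 * ((N : ℝ) - 4 * (j : ℝ) - 2) ^ 2 ∧
        C 1 = (N : ℝ) * ((N : ℝ) - 1) / 2 ^ (4 * m + 2) *
              ∑ j ∈ Finset.Icc 1 m, ((N : ℝ) - 1) ^ (2 * m + 2 * j - 2)
            + ((N : ℝ) - 1) ^ (2 * m) / 2 ^ (4 * m + 2)) ∧
      ∀ u : EuclideanSpace ℝ (Fin N) → ℝ, HypBall.IsTest u →
        Integrable (fun x => HypBall.absRadNabla k u x ^ 2) (HypBall.vol N) ∧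
        Integrable (fun x => u x ^ 2) (HypBall.vol N) ∧
        (∀ i ∈ Finset.Icc 1 k,
          Integrable (fun x => u x ^ 2 / HypBall.rad x ^ (2 * i)) (HypBall.vol N)) ∧
        ∑ i ∈ Finset.Icc 1 k, C i * ∫ x, u x ^ 2 / HypBall.rad x ^ (2 * i) ∂(HypBall.vol N) ≤
          (∫ x, HypBall.absRadNabla k u x ^ 2 ∂(HypBall.vol N)) -
            (((N : ℝ) - 1) / 2) ^ (2 * k) * ∫ x, u x ^ 2 ∂(HypBall.vol N) := by
  obtain ⟨n, rfl⟩ : ∃ n, N = n + 1 := ⟨N - 1, by omega⟩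
  obtain ⟨C, hC, heven, hodd, h⟩ := HypBall.radial_inequality k n hk (by omega)
  simp only [Nat.cast_add, Nat.cast_one, add_sub_cancel_right]
  refine ⟨C, hC, heven, hodd, fun u hu => ?_⟩
  have hN1 : 1 ≤ n + 1 := by omega
  exact ⟨hu.shellTest.integrable_absRadNabla_sq hN1 k,
    by simpa using hu.shellTest.integrable_sq_div_rad_pow hN1 0,
    fun i _ => hu.shellTest.integrable_sq_div_rad_pow hN1 i,
    hu.shellTest.sum_le_of_radial k C _ h⟩
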